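/- Double categories are pseudo double categories: arrows and cells compose strictly in the internal direction, while the external composition of proarrows (and of cells along arrows) is associative and unital up to coherent invertible globular cells; $x \odot y$ denotes external composition in diagrammatic order and $\mathrm{id}_x$ the external identity. Double functors are pseudo double functors. A \emph{companion} of an arrow $f: x \to y$ is a proarrow $f_!: x \nrightarrow y$ with cells $\eta: \mathrm{id}_x \to f_!$ (left side $1_x$, right side $f$) and $\varepsilon: f_! \to \mathrm{id}_y$ (left side $f$, right side $1_y$) whose internal composite is $\mathrm{id}_f$ and whose external composite is, up to unitors, the identity cell of $f_!$. A cell $\alpha: m \to n$ with left side $f$ and right side $g$ is a \emph{commuter} if $f$ and $g$ have companions and the globular cell $m \odot g_! \to f_! \odot n$ obtained from $\alpha$ by pasting with the unit of $f_!$ and the counit of $g_!$ is invertible (this does not depend on the choice of companions). Let $\mathbb{D}$ and $\mathbb{E}$ be double categories. Let $F, G: \mathbb{D} \to \mathbb{E}$ be lax double functors. A natural transformation $\alpha: F \Rightarrow G$ has component arrows $\alpha_x: Fx \to Gx$ and component cells $\alpha_m: Fm \to Gm$ with sides $\alpha_x, \alpha_y$ for $m: x \nrightarrow y$, strictly natural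 in arrows and cells and compatible with the lax comparison cells. An \emph{oplax protransformation} $\tau: F \nrightarrow G$ has component proarrows $\tau_x: Fx \nrightarrow Gx$, component cells $\tau_f: \tau_x \to \tau_y$ with sides $Ff, Gf$ for arrows $f: x \to y$, and globular comparison cells $\tau_m: Fm \odot \tau_y \to \tau_x \odot Gm$ for proarrows $m: x \nrightarrow y$, such that $\tau_f$ is functorial in $f$, $\tau_m$ is natural with respect to the cells of $\mathbb{D}$, and $\tau_m$ is coherent with external composites and identities; it is \emph{pseudo} if every $\tau_m$ is invertible. A \emph{modification} $\mu: \sigma \to \tau$ with left side $\alpha: F \Rightarrow H$ and right side $\beta: G \Rightarrow K$, between protransformations $\sigma: F \nrightarrow G$ and $\tau: H \nrightarrow K$, consists of cells $\mu_x: \sigma_x \to \tau_x$ with sides $\alpha_x, \beta_x$ that commute with the component cells $\sigma_f, \tau_f$ and with the comparison cells $\sigma_m, \tau_m$. Let $\mathbf{LaxOpl}(\mathbb{D},\mathbb{E})$ (respectively $\mathbf{LaxPs}(\mathbb{D},\mathbb{E})$) be the double category of lax double functors $\mathbb{D} \to \mathbb{E}$, natural transformations, oplax (respectively pseudo) protransformations,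 and modifications. Let $\mathbf{LaxComp}(\mathbb{D},\mathbb{E})$ be the strict double category whose objects are lax double functors $\mathbb{D} \to \mathbb{E}$, whose arrows are natural transformations all of whose component arrows have companions, whose proarrows are arbitrary natural transformations, and whose cells with top $\gamma: F \Rightarrow G$, bottom $\delta: H \Rightarrow K$, left side $\alpha: F \Rightarrow H$ and right side $\beta: G \Rightarrow K$ are the modifications $\beta \circ \gamma \Rrightarrow \delta \circ \alpha$, that is, modifications from the identity protransformation of $F$ to that of $K$ with left side $\beta \circ \gamma$ and right side $\delta \circ \alpha$. Let $\mathbf{LaxCC}(\mathbb{D},\mathbb{E})$ be defined in the same way, except that the arrows are the natural transformations whose component arrows have companions and whose component cells are commuters. For a strict double category $\mathbb{X}$, the transpose $\mathbb{X}^\top$ is obtained by interchanging arrows and proarrows. \textbf{Theorem.} For any double categories $\mathbb{D}$ and $\mathbb{E}$, there are double functors $$\mathbf{LaxComp}(\mathbb{D},\mathbb{E})^\top \to \mathbf{LaxOpl}(\mathbb{D},\mathbb{E}) \qquad\text{and}\qquad \mathbf{LaxCC}(\mathbb{D},\mathbb{E})^\top \to \mathbf{LaxPs}(\mathbb{D},\mathbb{E})$$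 that act as identities on objects (lax double functors) and arrows (natural transformations), and that send each proarrow, that is, each natural transformation $\alpha$ whose component arrows have companions (respectively, and whose component cells are commuters), to an oplax (respectively pseudo) protransformation that is a companion of $\alpha$ in $\mathbf{LaxOpl}(\mathbb{D},\mathbb{E})$ (respectively in $\mathbf{LaxPs}(\mathbb{D},\mathbb{E})$). -/

import Mathlib

open CategoryTheory

universe u v w t u₁ v₁ w₁ t₁ u₂ v₂ w₂ t₂

/-- The objects of the category of proarrows and cells: a proarrow with its endpoints. -/
structure ProObj {Obj : Type u} (Pro : Obj → Obj → Type w) where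
  {src : Obj}
  {tgt : Obj}
  pro : Pro src tgt

/-- A (pseudo) double category: a pseudocategory internal to categories. The objects and arrows form
the category `Obj`; the proarrows and cells form a category, whose composition is the (strict)
internal composition of cells. A cell `α : ⟨m⟩ ⟶ ⟨n⟩` has top `m`, bottom `n`, and boundary arrows
`left α`, `right α`. External composition of proarrows and of cells is written in diagrammatic
order. -/
structure DoubleCategory where
  Obj : Type u
  [cat : Category.{v} Obj]
  Pro : Obj → Obj → Type w
  [sqCat : Category.{t} (ProObj Pro)]
  left {m n : ProObj Pro} : (m ⟶ n) → (m.src ⟶ n.src)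
  right {m n : ProObj Pro} : (m ⟶ n) → (m.tgt ⟶ n.tgt)
  left_one (m : ProObj Pro) : left (𝟙 m) = 𝟙 m.src
  right_one (m : ProObj Pro) : right (𝟙 m) = 𝟙 m.tgt
  left_comp {m n p : ProObj Pro} (α : m ⟶ n) (β : n ⟶ p) : left (α ≫ β) = left α ≫ left β
  right_comp {m n p : ProObj Pro} (α : m ⟶ n) (β : n ⟶ p) : right (α ≫ β) = right α ≫ right β
  /-- the external identity proarrow -/
  hid (x : Obj) : Pro x x
  /-- the external identity cell on an arrow -/
  hidSq {x y : Obj} (f : x ⟶ y) : ProObj.mk (hid x) ⟶ ProObj.mk (hid y)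
  left_hidSq {x y : Obj} (f : x ⟶ y) : left (hidSq f) = f
  right_hidSq {x y : Obj} (f : x ⟶ y) : right (hidSq f) = f
  hidSq_id (x : Obj) : hidSq (𝟙 x) = 𝟙 (ProObj.mk (hid x))
  hidSq_comp {x y z : Obj} (f : x ⟶ y) (g : y ⟶ z) : hidSq (f ≫ g) = hidSq f ≫ hidSq g
  /-- external composition of proarrows -/
  hcomp {x y z : Obj} (m : Pro x y) (n : Pro y z) : Pro x z
  /-- external composition of cells -/
  hsq {x y z x' y' z' : Obj} {m : Pro x y} {n : Pro y z} {m' : Pro x' y'} {n' : Pro y' z'}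
    (α : ProObj.mk m ⟶ ProObj.mk m') (β : ProObj.mk n ⟶ ProObj.mk n') (h : right α = left β) :
    ProObj.mk (hcomp m n) ⟶ ProObj.mk (hcomp m' n')
  left_hsq {x y z x' y' z' : Obj} {m : Pro x y} {n : Pro y z} {m' : Pro x' y'} {n' : Pro y' z'}
    (α : ProObj.mk m ⟶ ProObj.mk m') (β : ProObj.mk n ⟶ ProObj.mk n') (h : right α = left β) :
    left (hsq α β h) = left α
  right_hsq {x y z x' y' z' : Obj} {m : Pro x y} {n : Pro y z} {m' : Pro x' y'} {n' : Pro y' z'}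
    (α : ProObj.mk m ⟶ ProObj.mk m') (β : ProObj.mk n ⟶ ProObj.mk n') (h : right α = left β) :
    right (hsq α β h) = right β
  hsq_one {x y z : Obj} (m : Pro x y) (n : Pro y z) :
    hsq (𝟙 (ProObj.mk m)) (𝟙 (ProObj.mk n)) ((right_one (ProObj.mk m)).trans (left_one (ProObj.mk n)).symm) =
      𝟙 (ProObj.mk (hcomp m n))
  /-- interchange -/
  hsq_comp {x y z x' y' z' x'' y'' z'' : Obj} {m : Pro x y} {n : Pro y z} {m' : Pro x' y'}
    {n' : Pro y' z'} {m'' : Pro x'' y''} {n'' : Pro y'' z''}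
    (α : ProObj.mk m ⟶ ProObj.mk m') (β : ProObj.mk n ⟶ ProObj.mk n') (h : right α = left β)
    (α' : ProObj.mk m' ⟶ ProObj.mk m'') (β' : ProObj.mk n' ⟶ ProObj.mk n'')
    (h' : right α' = left β') :
    hsq (α ≫ α') (β ≫ β')
      ((right_comp _ _).trans ((congrArg₂ (· ≫ ·) h h').trans (left_comp _ _).symm)) =
      hsq α β h ≫ hsq α' β' h'
  /-- associators -/
  assoc {x y z a : Obj} (m : Pro x y) (n : Pro y z) (p : Pro z a) :
    ProObj.mk (hcomp (hcomp m n) p) ≅ ProObj.mk (hcomp m (hcomp n p))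
  left_assoc {x y z a : Obj} (m : Pro x y) (n : Pro y z) (p : Pro z a) :
    left (assoc m n p).hom = 𝟙 x
  right_assoc {x y z a : Obj} (m : Pro x y) (n : Pro y z) (p : Pro z a) :
    right (assoc m n p).hom = 𝟙 a
  assoc_naturality {x y z a x' y' z' a' : Obj} {m : Pro x y} {n : Pro y z} {p : Pro z a}
    {m' : Pro x' y'} {n' : Pro y' z'} {p' : Pro z' a'}
    (α : ProObj.mk m ⟶ ProObj.mk m') (β : ProObj.mk n ⟶ ProObj.mk n')
    (γ : ProObj.mk p ⟶ ProObj.mk p') (h : right α = left β) (h' : right β = left γ) :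
    hsq (hsq α β h) γ ((right_hsq _ _ _).trans h') ≫ (assoc m' n' p').hom =
      (assoc m n p).hom ≫ hsq α (hsq β γ h') (h.trans (left_hsq _ _ _).symm)
  /-- unitors -/
  lunit {x y : Obj} (m : Pro x y) : ProObj.mk (hcomp (hid x) m) ≅ ProObj.mk m
  left_lunit {x y : Obj} (m : Pro x y) : left (lunit m).hom = 𝟙 x
  right_lunit {x y : Obj} (m : Pro x y) : right (lunit m).hom = 𝟙 y
  lunit_naturality {x y x' y' : Obj} {m : Pro x y} {m' : Pro x' y'}
    (α : ProObj.mk m ⟶ ProObj.mk m') :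
    hsq (hidSq (left α)) α (right_hidSq _) ≫ (lunit m').hom = (lunit m).hom ≫ α
  runit {x y : Obj} (m : Pro x y) : ProObj.mk (hcomp m (hid y)) ≅ ProObj.mk m
  left_runit {x y : Obj} (m : Pro x y) : left (runit m).hom = 𝟙 x
  right_runit {x y : Obj} (m : Pro x y) : right (runit m).hom = 𝟙 y
  runit_naturality {x y x' y' : Obj} {m : Pro x y} {m' : Pro x' y'}
    (α : ProObj.mk m ⟶ ProObj.mk m') :
    hsq α (hidSq (right α)) (left_hidSq _).symm ≫ (runit m').hom = (runit m).hom ≫ α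
  pentagon {x y z a b : Obj} (m : Pro x y) (n : Pro y z) (p : Pro z a) (q : Pro a b) :
    hsq (assoc m n p).hom (𝟙 (ProObj.mk q)) ((right_assoc _ _ _).trans (left_one (ProObj.mk q)).symm) ≫
        (assoc m (hcomp n p) q).hom ≫
        hsq (𝟙 (ProObj.mk m)) (assoc n p q).hom ((right_one (ProObj.mk m)).trans (left_assoc _ _ _).symm) =
      (assoc (hcomp m n) p q).hom ≫ (assoc m n (hcomp p q)).hom
  triangle {x y z : Obj} (m : Pro x y) (n : Pro y z) :
    (assoc m (hid y) n).hom ≫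
        hsq (𝟙 (ProObj.mk m)) (lunit n).hom ((right_one (ProObj.mk m)).trans (left_lunit _).symm) =
      hsq (runit m).hom (𝟙 (ProObj.mk n)) ((right_runit _).trans (left_one (ProObj.mk n)).symm)

namespace DoubleCategory

attribute [instance] cat sqCat
attribute [simp] left_one right_one left_comp right_comp left_hidSq right_hidSq left_hsq right_hsq
  left_assoc right_assoc left_lunit right_lunit left_runit right_runit hidSq_id hsq_one

/-- Cells with top `m` and bottom `n`. -/
abbrev Sq (X : DoubleCategory.{u, v, w, t}) {x y x' y' : X.Obj} (m : X.Pro x y) (n : X.Pro x' y') :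
    Type t :=
  ProObj.mk m ⟶ ProObj.mk n

variable (X : DoubleCategory.{u, v, w, t})

/-- The internal identity cell on a proarrow. -/
abbrev one {x y : X.Obj} (m : X.Pro x y) : X.Sq m m := 𝟙 (ProObj.mk m)

variable {X}

section lemmas

variable {x y z a b x' y' z' : X.Obj}

lemma left_inv {m n : ProObj X.Pro} (e : m ≅ n) :
    X.left e.inv ≫ X.left e.hom = 𝟙 _ := by
  rw [← left_comp, e.inv_hom_id, left_one]

lemma right_inv {m n : ProObj X.Pro} (e : m ≅ n) :
    X.right e.inv ≫ X.right e.hom = 𝟙 _ := by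
  rw [← right_comp, e.inv_hom_id, right_one]

@[simp] lemma left_assoc_inv (m : X.Pro x y) (n : X.Pro y z) (p : X.Pro z a) :
    X.left (X.assoc m n p).inv = 𝟙 x := by
  simpa using left_inv (X.assoc m n p)

@[simp] lemma right_assoc_inv (m : X.Pro x y) (n : X.Pro y z) (p : X.Pro z a) :
    X.right (X.assoc m n p).inv = 𝟙 a := by
  simpa using right_inv (X.assoc m n p)

@[simp] lemma left_lunit_inv (m : X.Pro x y) : X.left (X.lunit m).inv = 𝟙 x := by
  simpa using left_inv (X.lunit m)

@[simp] lemma right_lunit_inv (m : X.Pro x y) : X.right (X.lunit m).inv = 𝟙 y := by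
  simpa using right_inv (X.lunit m)

@[simp] lemma left_runit_inv (m : X.Pro x y) : X.left (X.runit m).inv = 𝟙 x := by
  simpa using left_inv (X.runit m)

@[simp] lemma right_runit_inv (m : X.Pro x y) : X.right (X.runit m).inv = 𝟙 y := by
  simpa using right_inv (X.runit m)

lemma left_isIso_inv {m n : ProObj X.Pro} (α : m ⟶ n) [IsIso α] :
    X.left (inv α) ≫ X.left α = 𝟙 _ := left_inv (asIso α)

lemma right_isIso_inv {m n : ProObj X.Pro} (α : m ⟶ n) [IsIso α] :
    X.right (inv α) ≫ X.right α = 𝟙 _ := right_inv (asIso α)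

lemma hsq_hsq {x y z x' y' z' x'' y'' z'' : X.Obj} {m : X.Pro x y} {n : X.Pro y z}
    {m' : X.Pro x' y'} {n' : X.Pro y' z'} {m'' : X.Pro x'' y''} {n'' : X.Pro y'' z''}
    (α : X.Sq m m') (β : X.Sq n n') (h) (α' : X.Sq m' m'') (β' : X.Sq n' n'') (h') :
    X.hsq α β h ≫ X.hsq α' β' h' =
      X.hsq (α ≫ α') (β ≫ β') (by simp only [left_comp, right_comp, h, h']) :=
  (X.hsq_comp α β h α' β' h').symm

lemma hsq_congr {m : X.Pro x y} {n : X.Pro y z} {m' : X.Pro x' y'} {n' : X.Pro y' z'}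
    {α α' : X.Sq m m'} {β β' : X.Sq n n'} (h : X.right α = X.left β) (e : α = α') (e' : β = β') :
    X.hsq α β h = X.hsq α' β' (by rw [← e, ← e', h]) := by
  subst e e'; rfl

lemma hsq_eq_one {m : X.Pro x y} {n : X.Pro y z} {α : X.Sq m m} {β : X.Sq n n}
    (h : X.right α = X.left β) (e : α = 𝟙 _) (e' : β = 𝟙 _) : X.hsq α β h = 𝟙 _ := by
  subst e e'; exact X.hsq_one _ _

lemma assoc_inv_naturality {x y z a x' y' z' a' : X.Obj} {m : X.Pro x y} {n : X.Pro y z}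
    {p : X.Pro z a} {m' : X.Pro x' y'} {n' : X.Pro y' z'} {p' : X.Pro z' a'}
    (α : X.Sq m m') (β : X.Sq n n') (γ : X.Sq p p') (h : X.right α = X.left β)
    (h' : X.right β = X.left γ) :
    X.hsq α (X.hsq β γ h') (h.trans (X.left_hsq _ _ _).symm) ≫ (X.assoc m' n' p').inv =
      (X.assoc m n p).inv ≫ X.hsq (X.hsq α β h) γ ((X.right_hsq _ _ _).trans h') := by
  rw [Iso.comp_inv_eq, Category.assoc, Iso.eq_inv_comp, assoc_naturality]

lemma lunit_inv_naturality {m : X.Pro x y} {m' : X.Pro x' y'} (α : X.Sq m m') :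
    α ≫ (X.lunit m').inv = (X.lunit m).inv ≫ X.hsq (X.hidSq (X.left α)) α (X.right_hidSq _) := by
  rw [Iso.comp_inv_eq, Category.assoc, Iso.eq_inv_comp, lunit_naturality]

lemma runit_inv_naturality {m : X.Pro x y} {m' : X.Pro x' y'} (α : X.Sq m m') :
    α ≫ (X.runit m').inv =
      (X.runit m).inv ≫ X.hsq α (X.hidSq (X.right α)) (X.left_hidSq _).symm := by
  rw [Iso.comp_inv_eq, Category.assoc, Iso.eq_inv_comp, runit_naturality]

lemma lunit_naturality' {m : X.Pro x y} {m' : X.Pro x' y'} (α : X.Sq m m') {f : x ⟶ x'}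
    (hf : X.left α = f) :
    X.hsq (X.hidSq f) α (by simp [hf]) ≫ (X.lunit m').hom = (X.lunit m).hom ≫ α := by
  subst hf; exact X.lunit_naturality α

lemma runit_naturality' {m : X.Pro x y} {m' : X.Pro x' y'} (α : X.Sq m m') {f : y ⟶ y'}
    (hf : X.right α = f) :
    X.hsq α (X.hidSq f) (by simp [hf]) ≫ (X.runit m').hom = (X.runit m).hom ≫ α := by
  subst hf; exact X.runit_naturality α

section reassociated

variable {q : ProObj X.Pro}

lemma hsq_hsq_assoc {x y z x' y' z' x'' y'' z'' : X.Obj} {m : X.Pro x y} {n : X.Pro y z}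
    {m' : X.Pro x' y'} {n' : X.Pro y' z'} {m'' : X.Pro x'' y''} {n'' : X.Pro y'' z''}
    (α : X.Sq m m') (β : X.Sq n n') (h) (α' : X.Sq m' m'') (β' : X.Sq n' n'') (h')
    (k : ProObj.mk (X.hcomp m'' n'') ⟶ q) :
    X.hsq α β h ≫ X.hsq α' β' h' ≫ k =
      X.hsq (α ≫ α') (β ≫ β') (by simp only [left_comp, right_comp, h, h']) ≫ k := by
  rw [← Category.assoc, hsq_hsq]

lemma assoc_naturality_assoc {x y z a x' y' z' a' : X.Obj} {m : X.Pro x y} {n : X.Pro y z}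
    {p : X.Pro z a} {m' : X.Pro x' y'} {n' : X.Pro y' z'} {p' : X.Pro z' a'}
    (α : X.Sq m m') (β : X.Sq n n') (γ : X.Sq p p') (h : X.right α = X.left β)
    (h' : X.right β = X.left γ) (k : ProObj.mk (X.hcomp m' (X.hcomp n' p')) ⟶ q) :
    X.hsq (X.hsq α β h) γ ((X.right_hsq _ _ _).trans h') ≫ (X.assoc m' n' p').hom ≫ k =
      (X.assoc m n p).hom ≫ X.hsq α (X.hsq β γ h') (h.trans (X.left_hsq _ _ _).symm) ≫ k := by
  rw [← Category.assoc, assoc_naturality, Category.assoc]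

lemma assoc_inv_naturality_assoc {x y z a x' y' z' a' : X.Obj} {m : X.Pro x y} {n : X.Pro y z}
    {p : X.Pro z a} {m' : X.Pro x' y'} {n' : X.Pro y' z'} {p' : X.Pro z' a'}
    (α : X.Sq m m') (β : X.Sq n n') (γ : X.Sq p p') (h : X.right α = X.left β)
    (h' : X.right β = X.left γ) (k : ProObj.mk (X.hcomp (X.hcomp m' n') p') ⟶ q) :
    X.hsq α (X.hsq β γ h') (h.trans (X.left_hsq _ _ _).symm) ≫ (X.assoc m' n' p').inv ≫ k =
      (X.assoc m n p).inv ≫ X.hsq (X.hsq α β h) γ ((X.right_hsq _ _ _).trans h') ≫ k := by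
  rw [← Category.assoc, assoc_inv_naturality, Category.assoc]

lemma lunit_inv_naturality_assoc {m : X.Pro x y} {m' : X.Pro x' y'} (α : X.Sq m m')
    (k : ProObj.mk (X.hcomp (X.hid x') m') ⟶ q) :
    α ≫ (X.lunit m').inv ≫ k =
      (X.lunit m).inv ≫ X.hsq (X.hidSq (X.left α)) α (X.right_hidSq _) ≫ k := by
  rw [← Category.assoc, lunit_inv_naturality, Category.assoc]

lemma runit_inv_naturality_assoc {m : X.Pro x y} {m' : X.Pro x' y'} (α : X.Sq m m')
    (k : ProObj.mk (X.hcomp m' (X.hid y')) ⟶ q) :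
    α ≫ (X.runit m').inv ≫ k =
      (X.runit m).inv ≫ X.hsq α (X.hidSq (X.right α)) (X.left_hidSq _).symm ≫ k := by
  rw [← Category.assoc, runit_inv_naturality, Category.assoc]

lemma lunit_naturality'_assoc {m : X.Pro x y} {m' : X.Pro x' y'} (α : X.Sq m m') {f : x ⟶ x'}
    (hf : X.left α = f) (k : ProObj.mk m' ⟶ q) :
    X.hsq (X.hidSq f) α (by simp [hf]) ≫ (X.lunit m').hom ≫ k = (X.lunit m).hom ≫ α ≫ k := by
  rw [← Category.assoc, lunit_naturality' α hf, Category.assoc]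

lemma runit_naturality'_assoc {m : X.Pro x y} {m' : X.Pro x' y'} (α : X.Sq m m') {f : y ⟶ y'}
    (hf : X.right α = f) (k : ProObj.mk m' ⟶ q) :
    X.hsq α (X.hidSq f) (by simp [hf]) ≫ (X.runit m').hom ≫ k = (X.runit m).hom ≫ α ≫ k := by
  rw [← Category.assoc, runit_naturality' α hf, Category.assoc]

end reassociated

end lemmas

/-- The objects of `X`, viewed as the objects of the underlying bicategory of `X`. -/
structure Hor (X : DoubleCategory.{u, v, w, t}) where
  of : X.Obj

/-- Globular cells. -/
structure Glob {x y : X.Obj} (m n : X.Pro x y) where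
  sq : X.Sq m n
  left : X.left sq = 𝟙 x
  right : X.right sq = 𝟙 y

attribute [simp] Glob.left Glob.right

lemma Glob.ext {x y : X.Obj} {m n : X.Pro x y} {α β : Glob m n} (h : α.sq = β.sq) : α = β := by
  cases α; cases β; cases h; rfl

instance (x y : X.Obj) : Category (X.Pro x y) where
  Hom m n := Glob m n
  id m := ⟨𝟙 _, by simp, by simp⟩
  comp α β := ⟨α.sq ≫ β.sq, by simp, by simp⟩
  id_comp α := Glob.ext (Category.id_comp _)
  comp_id α := Glob.ext (Category.comp_id _)
  assoc α β γ := Glob.ext (Category.assoc _ _ _)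

/-- The underlying bicategory: objects, proarrows and globular cells. -/
instance : Bicategory (Hor X) where
  Hom x y := X.Pro x.of y.of
  id x := X.hid x.of
  comp m n := X.hcomp m n
  homCategory x y := inferInstanceAs (Category (X.Pro x.of y.of))
  whiskerLeft m _ _ α := ⟨X.hsq (X.one m) α.sq (by simp), by simp, by simp⟩
  whiskerRight α n := ⟨X.hsq α.sq (X.one n) (by simp), by simp, by simp⟩
  associator m n p :=
    { hom := ⟨(X.assoc m n p).hom, by simp, by simp⟩
      inv := ⟨(X.assoc m n p).inv, by simp, by simp⟩
      hom_inv_id := Glob.ext (X.assoc m n p).hom_inv_id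
      inv_hom_id := Glob.ext (X.assoc m n p).inv_hom_id }
  leftUnitor m :=
    { hom := ⟨(X.lunit m).hom, by simp, by simp⟩
      inv := ⟨(X.lunit m).inv, by simp, by simp⟩
      hom_inv_id := Glob.ext (X.lunit m).hom_inv_id
      inv_hom_id := Glob.ext (X.lunit m).inv_hom_id }
  rightUnitor m :=
    { hom := ⟨(X.runit m).hom, by simp, by simp⟩
      inv := ⟨(X.runit m).inv, by simp, by simp⟩
      hom_inv_id := Glob.ext (X.runit m).hom_inv_id
      inv_hom_id := Glob.ext (X.runit m).inv_hom_id }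
  whiskerLeft_id m n := Glob.ext (X.hsq_one m n)
  whiskerLeft_comp m _ _ _ α β := Glob.ext <| by
    change X.hsq _ (α.sq ≫ β.sq) _ = X.hsq _ _ _ ≫ X.hsq _ _ _
    rw [hsq_hsq]; exact hsq_congr _ (by simp) rfl
  id_whiskerLeft α := Glob.ext <| by
    change X.hsq _ α.sq _ = (X.lunit _).hom ≫ α.sq ≫ (X.lunit _).inv
    rw [← lunit_naturality'_assoc α.sq α.left, Iso.hom_inv_id, Category.comp_id]
    exact hsq_congr _ (by simp) rfl
  comp_whiskerLeft m n _ _ α := Glob.ext <| by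
    change X.hsq (X.one _) α.sq _ = (X.assoc _ _ _).hom ≫ X.hsq _ (X.hsq _ _ _) _ ≫ (X.assoc _ _ _).inv
    rw [← Iso.inv_comp_eq, assoc_inv_naturality _ _ _ (by simp)]
    congr 1
    exact hsq_congr _ (by simp) rfl
  id_whiskerRight m n := Glob.ext (X.hsq_one m n)
  comp_whiskerRight α β n := Glob.ext <| by
    change X.hsq (α.sq ≫ β.sq) _ _ = X.hsq _ _ _ ≫ X.hsq _ _ _
    rw [hsq_hsq]; exact hsq_congr _ rfl (by simp)
  whiskerRight_id α := Glob.ext <| by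
    change X.hsq α.sq _ _ = (X.runit _).hom ≫ α.sq ≫ (X.runit _).inv
    rw [← runit_naturality'_assoc α.sq α.right, Iso.hom_inv_id, Category.comp_id]
    exact hsq_congr _ rfl (by simp)
  whiskerRight_comp α n p := Glob.ext <| by
    change X.hsq α.sq (X.one _) _ = (X.assoc _ _ _).inv ≫ X.hsq (X.hsq _ _ _) _ _ ≫ (X.assoc _ _ _).hom
    rw [Iso.eq_inv_comp, X.assoc_naturality α.sq (X.one n) (X.one p) (by simp) (by simp)]
    congr 1
    exact hsq_congr _ rfl (by simp)
  whisker_assoc m _ _ α p := Glob.ext <| by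
    change X.hsq (X.hsq _ α.sq _) _ _ = (X.assoc _ _ _).hom ≫ X.hsq _ (X.hsq _ _ _) _ ≫ (X.assoc _ _ _).inv
    rw [← Category.assoc, ← assoc_naturality, Category.assoc, Iso.hom_inv_id, Category.comp_id]
  whisker_exchange α β := Glob.ext <| by
    change X.hsq _ _ _ ≫ X.hsq _ _ _ = X.hsq _ _ _ ≫ X.hsq _ _ _
    rw [hsq_hsq, hsq_hsq]; exact hsq_congr _ (by simp) (by simp)
  pentagon m n p q := Glob.ext (X.pentagon m n p q)
  triangle m n := Glob.ext (X.triangle m n)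

end DoubleCategory

namespace DoubleCategory

/-- A lax double functor: a functor on objects and arrows, a functor on proarrows and cells
compatible with the boundaries, and coherent globular comparison cells. -/
structure LaxDoubleFunctor (D : DoubleCategory.{u₁, v₁, w₁, t₁})
    (E : DoubleCategory.{u₂, v₂, w₂, t₂}) extends D.Obj ⥤ E.Obj where
  pro {x y : D.Obj} : D.Pro x y → E.Pro (obj x) (obj y)
  sq {x y x' y' : D.Obj} {m : D.Pro x y} {n : D.Pro x' y'} : D.Sq m n → E.Sq (pro m) (pro n)
  left_sq {x y x' y' : D.Obj} {m : D.Pro x y} {n : D.Pro x' y'} (α : D.Sq m n) :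
    E.left (sq α) = map (D.left α)
  right_sq {x y x' y' : D.Obj} {m : D.Pro x y} {n : D.Pro x' y'} (α : D.Sq m n) :
    E.right (sq α) = map (D.right α)
  sq_one {x y : D.Obj} (m : D.Pro x y) : sq (D.one m) = E.one (pro m)
  sq_comp {x y x' y' x'' y'' : D.Obj} {m : D.Pro x y} {n : D.Pro x' y'} {p : D.Pro x'' y''}
    (α : D.Sq m n) (β : D.Sq n p) : sq (α ≫ β) = sq α ≫ sq β
  /-- the comparison for external composition -/
  lax {x y z : D.Obj} (m : D.Pro x y) (n : D.Pro y z) :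
    E.Sq (E.hcomp (pro m) (pro n)) (pro (D.hcomp m n))
  left_lax {x y z : D.Obj} (m : D.Pro x y) (n : D.Pro y z) : E.left (lax m n) = 𝟙 (obj x)
  right_lax {x y z : D.Obj} (m : D.Pro x y) (n : D.Pro y z) : E.right (lax m n) = 𝟙 (obj z)
  /-- the comparison for external identities -/
  unit (x : D.Obj) : E.Sq (E.hid (obj x)) (pro (D.hid x))
  left_unit (x : D.Obj) : E.left (unit x) = 𝟙 (obj x)
  right_unit (x : D.Obj) : E.right (unit x) = 𝟙 (obj x)
  lax_naturality {x y z x' y' z' : D.Obj} {m : D.Pro x y} {n : D.Pro y z} {m' : D.Pro x' y'}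
    {n' : D.Pro y' z'} (α : D.Sq m m') (β : D.Sq n n') (h : D.right α = D.left β) :
    E.hsq (sq α) (sq β) (by rw [right_sq, left_sq, h]) ≫ lax m' n' =
      lax m n ≫ sq (D.hsq α β h)
  unit_naturality {x y : D.Obj} (f : x ⟶ y) :
    E.hidSq (map f) ≫ unit y = unit x ≫ sq (D.hidSq f)
  lax_assoc {x y z a : D.Obj} (m : D.Pro x y) (n : D.Pro y z) (p : D.Pro z a) :
    E.hsq (lax m n) (E.one (pro p)) (by simp [right_lax]) ≫ lax (D.hcomp m n) p ≫
        sq (D.assoc m n p).hom =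
      (E.assoc (pro m) (pro n) (pro p)).hom ≫
        E.hsq (E.one (pro m)) (lax n p) (by simp [left_lax]) ≫ lax m (D.hcomp n p)
  lax_lunit {x y : D.Obj} (m : D.Pro x y) :
    E.hsq (unit x) (E.one (pro m)) (by simp [right_unit]) ≫ lax (D.hid x) m ≫
      sq (D.lunit m).hom = (E.lunit (pro m)).hom
  lax_runit {x y : D.Obj} (m : D.Pro x y) :
    E.hsq (E.one (pro m)) (unit y) (by simp [left_unit]) ≫ lax m (D.hid y) ≫
      sq (D.runit m).hom = (E.runit (pro m)).hom

/-- A (pseudo) double functor: a lax one whose comparison cells are invertible. -/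
structure DoubleFunctor (D : DoubleCategory.{u₁, v₁, w₁, t₁})
    (E : DoubleCategory.{u₂, v₂, w₂, t₂}) extends LaxDoubleFunctor D E where
  isIso_lax {x y z : D.Obj} (m : D.Pro x y) (n : D.Pro y z) : IsIso (lax m n)
  isIso_unit (x : D.Obj) : IsIso (unit x)

variable {D : DoubleCategory.{u₁, v₁, w₁, t₁}} {E : DoubleCategory.{u₂, v₂, w₂, t₂}}

namespace LaxDoubleFunctor

attribute [simp] left_sq right_sq left_lax right_lax left_unit right_unit sq_one

/-- A (tight, strict) natural transformation between lax double functors. -/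
@[ext]
structure NatTrans (F G : LaxDoubleFunctor D E) where
  app (x : D.Obj) : F.obj x ⟶ G.obj x
  naturality {x y : D.Obj} (f : x ⟶ y) : F.map f ≫ app y = app x ≫ G.map f
  sq {x y : D.Obj} (m : D.Pro x y) : E.Sq (F.pro m) (G.pro m)
  left_sq {x y : D.Obj} (m : D.Pro x y) : E.left (sq m) = app x
  right_sq {x y : D.Obj} (m : D.Pro x y) : E.right (sq m) = app y
  sq_naturality {x y x' y' : D.Obj} {m : D.Pro x y} {n : D.Pro x' y'} (γ : D.Sq m n) :
    F.sq γ ≫ sq n = sq m ≫ G.sq γ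
  sq_hcomp {x y z : D.Obj} (m : D.Pro x y) (n : D.Pro y z) :
    F.lax m n ≫ sq (D.hcomp m n) =
      E.hsq (sq m) (sq n) ((right_sq m).trans (left_sq n).symm) ≫ G.lax m n
  sq_hid (x : D.Obj) : F.unit x ≫ sq (D.hid x) = E.hidSq (app x) ≫ G.unit x

attribute [simp] NatTrans.left_sq NatTrans.right_sq

instance : Category (LaxDoubleFunctor D E) where
  Hom := NatTrans
  id F :=
    { app x := 𝟙 (F.obj x)
      naturality f := by simp
      sq m := E.one (F.pro m)
      left_sq m := by simp
      right_sq m := by simp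
      sq_naturality γ := by simp
      sq_hcomp m n := by simp
      sq_hid x := by simp }
  comp {F G H} α β :=
    { app x := α.app x ≫ β.app x
      naturality f := by
        rw [← Category.assoc, α.naturality, Category.assoc, β.naturality, Category.assoc]
      sq m := α.sq m ≫ β.sq m
      left_sq m := by simp
      right_sq m := by simp
      sq_naturality γ := by
        rw [← Category.assoc, α.sq_naturality, Category.assoc, β.sq_naturality, Category.assoc]
      sq_hcomp m n := by
        rw [← Category.assoc, α.sq_hcomp, Category.assoc, β.sq_hcomp, ← Category.assoc, hsq_hsq]
      sq_hid x := by
        rw [← Category.assoc, α.sq_hid, Category.assoc, β.sq_hid, ← Category.assoc, hidSq_comp] }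
  id_comp α := NatTrans.ext (by funext; exact Category.id_comp _)
    (by funext x y m; exact Category.id_comp (α.sq m))
  comp_id α := NatTrans.ext (by funext; exact Category.comp_id _)
    (by funext x y m; exact Category.comp_id (α.sq m))
  assoc α β γ := NatTrans.ext (by funext; exact Category.assoc _ _ _)
    (by funext x y m; exact Category.assoc (α.sq m) (β.sq m) (γ.sq m))

@[simp] lemma id_app (F : LaxDoubleFunctor D E) (x : D.Obj) :
    NatTrans.app (𝟙 F) x = 𝟙 (F.obj x) := rfl

@[simp] lemma comp_app {F G H : LaxDoubleFunctor D E} (α : F ⟶ G) (β : G ⟶ H) (x : D.Obj) :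
    NatTrans.app (α ≫ β) x = NatTrans.app α x ≫ NatTrans.app β x := rfl

@[simp] lemma id_sq (F : LaxDoubleFunctor D E) {x y : D.Obj} (m : D.Pro x y) :
    NatTrans.sq (𝟙 F) m = E.one (F.pro m) := rfl

@[simp] lemma comp_sq {F G H : LaxDoubleFunctor D E} (α : F ⟶ G) (β : G ⟶ H) {x y : D.Obj}
    (m : D.Pro x y) : NatTrans.sq (α ≫ β) m = NatTrans.sq α m ≫ NatTrans.sq β m := rfl

/-- The lax functor between underlying bicategories. -/
def toHor (F : LaxDoubleFunctor D E) : LaxFunctor (Hor D) (Hor E) where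
  obj x := ⟨F.obj x.of⟩
  map m := F.pro m
  map₂ α := ⟨F.sq α.sq, by simp, by simp⟩
  mapId x := ⟨F.unit x.of, by simp, by simp⟩
  mapComp m n := ⟨F.lax m n, by simp, by simp⟩
  map₂_id m := Glob.ext (F.sq_one m)
  map₂_comp α β := Glob.ext (F.sq_comp α.sq β.sq)
  mapComp_naturality_left α m := Glob.ext <| by
    change F.lax _ _ ≫ F.sq (D.hsq _ _ _) = E.hsq _ _ _ ≫ F.lax _ _
    rw [← F.lax_naturality]; congr 1; exact hsq_congr _ rfl (by simp)
  mapComp_naturality_right m _ _ α := Glob.ext <| by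
    change F.lax _ _ ≫ F.sq (D.hsq _ _ _) = E.hsq _ _ _ ≫ F.lax _ _
    rw [← F.lax_naturality]; congr 1; exact hsq_congr _ (by simp) rfl
  map₂_associator m n p := Glob.ext (F.lax_assoc m n p)
  map₂_leftUnitor m := Glob.ext <| by
    change F.sq (D.lunit m).inv = (E.lunit (F.pro m)).inv ≫ E.hsq (F.unit _) _ _ ≫ F.lax _ _
    rw [Iso.eq_inv_comp, ← F.lax_lunit m, Category.assoc, Category.assoc, ← F.sq_comp,
      Iso.hom_inv_id, F.sq_one, Category.comp_id]
  map₂_rightUnitor m := Glob.ext <| by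
    change F.sq (D.runit m).inv = (E.runit (F.pro m)).inv ≫ E.hsq _ (F.unit _) _ ≫ F.lax _ _
    rw [Iso.eq_inv_comp, ← F.lax_runit m, Category.assoc, Category.assoc, ← F.sq_comp,
      Iso.hom_inv_id, F.sq_one, Category.comp_id]

end LaxDoubleFunctor

/-- An oplax protransformation between lax double functors. -/
structure OplaxProtrans (F G : LaxDoubleFunctor D E) where
  app (x : D.Obj) : E.Pro (F.obj x) (G.obj x)
  /-- the component at an arrow -/
  sq {x y : D.Obj} (f : x ⟶ y) : E.Sq (app x) (app y)
  left_sq {x y : D.Obj} (f : x ⟶ y) : E.left (sq f) = F.map f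
  right_sq {x y : D.Obj} (f : x ⟶ y) : E.right (sq f) = G.map f
  /-- the globular naturality comparison at a proarrow -/
  nat {x y : D.Obj} (m : D.Pro x y) :
    E.Sq (E.hcomp (F.pro m) (app y)) (E.hcomp (app x) (G.pro m))
  left_nat {x y : D.Obj} (m : D.Pro x y) : E.left (nat m) = 𝟙 (F.obj x)
  right_nat {x y : D.Obj} (m : D.Pro x y) : E.right (nat m) = 𝟙 (G.obj y)
  sq_id (x : D.Obj) : sq (𝟙 x) = E.one (app x)
  sq_comp {x y z : D.Obj} (f : x ⟶ y) (g : y ⟶ z) : sq (f ≫ g) = sq f ≫ sq g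
  naturality {x y x' y' : D.Obj} {m : D.Pro x y} {n : D.Pro x' y'} (γ : D.Sq m n) :
    E.hsq (F.sq γ) (sq (D.right γ)) ((F.right_sq γ).trans (left_sq _).symm) ≫ nat n =
      nat m ≫ E.hsq (sq (D.left γ)) (G.sq γ) ((right_sq _).trans (G.left_sq γ).symm)
  nat_hcomp {x y z : D.Obj} (m : D.Pro x y) (n : D.Pro y z) :
    E.hsq (F.lax m n) (E.one (app z)) (by simp) ≫ nat (D.hcomp m n) =
      (E.assoc (F.pro m) (F.pro n) (app z)).hom ≫
        E.hsq (E.one (F.pro m)) (nat n) (by simp [left_nat]) ≫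
        (E.assoc (F.pro m) (app y) (G.pro n)).inv ≫
        E.hsq (nat m) (E.one (G.pro n)) (by simp [right_nat]) ≫
        (E.assoc (app x) (G.pro m) (G.pro n)).hom ≫
        E.hsq (E.one (app x)) (G.lax m n) (by simp)
  nat_hid (x : D.Obj) :
    E.hsq (F.unit x) (E.one (app x)) (by simp) ≫ nat (D.hid x) =
      (E.lunit (app x)).hom ≫ (E.runit (app x)).inv ≫
        E.hsq (E.one (app x)) (G.unit x) (by simp)

namespace OplaxProtrans

attribute [simp] left_sq right_sq left_nat right_nat sq_id

/-- The oplax transformation between lax functors of underlying bicategories. -/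
def toHor {F G : LaxDoubleFunctor D E} (σ : OplaxProtrans F G) :
    Lax.OplaxTrans F.toHor G.toHor where
  app x := σ.app x.of
  naturality m := ⟨σ.nat m, σ.left_nat m, σ.right_nat m⟩
  naturality_naturality {x y m n} γ := Glob.ext <| by
    change E.hsq (F.sq γ.sq) (E.one _) _ ≫ σ.nat n = σ.nat m ≫ E.hsq (E.one _) (G.sq γ.sq) _
    have h := σ.naturality γ.sq
    have h₁ : σ.sq (D.right γ.sq) = E.one _ := by rw [γ.right, sq_id]
    have h₂ : σ.sq (D.left γ.sq) = E.one _ := by rw [γ.left, sq_id]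
    rw [hsq_congr _ rfl h₁, hsq_congr _ h₂ rfl] at h
    exact h
  naturality_id x := Glob.ext (σ.nat_hid x.of)
  naturality_comp m n := Glob.ext (σ.nat_hcomp m n)

/-- Pasting of two globular comparison squares. -/
def paste {x₀ x₁ x₂ y₀ y₁ y₂ : E.Obj} {a : E.Pro x₀ y₀} {b : E.Pro x₁ y₁} {c : E.Pro x₂ y₂}
    {p : E.Pro x₀ x₁} {q : E.Pro x₁ x₂} {p' : E.Pro y₀ y₁} {q' : E.Pro y₁ y₂}
    (s : E.Sq (E.hcomp a p') (E.hcomp p b)) (t : E.Sq (E.hcomp b q') (E.hcomp q c))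
    (hs : E.right s = 𝟙 _) (ht : E.left t = 𝟙 _) :
    E.Sq (E.hcomp a (E.hcomp p' q')) (E.hcomp (E.hcomp p q) c) :=
  (E.assoc a p' q').inv ≫ E.hsq s (E.one q') (by simp [hs]) ≫ (E.assoc p b q').hom ≫
    E.hsq (E.one p) t (by simp [ht]) ≫ (E.assoc p q c).inv

lemma paste_naturality {x₀ x₁ x₂ y₀ y₁ y₂ : E.Obj} {a : E.Pro x₀ y₀} {b : E.Pro x₁ y₁}
    {c : E.Pro x₂ y₂} {p : E.Pro x₀ x₁} {q : E.Pro x₁ x₂} {p' : E.Pro y₀ y₁} {q' : E.Pro y₁ y₂}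
    {s : E.Sq (E.hcomp a p') (E.hcomp p b)} {t : E.Sq (E.hcomp b q') (E.hcomp q c)}
    {hs : E.right s = 𝟙 _} {ht : E.left t = 𝟙 _}
    {X₀ X₁ X₂ Y₀ Y₁ Y₂ : E.Obj} {A : E.Pro X₀ Y₀} {B : E.Pro X₁ Y₁}
    {C : E.Pro X₂ Y₂} {P : E.Pro X₀ X₁} {Q : E.Pro X₁ X₂} {P' : E.Pro Y₀ Y₁} {Q' : E.Pro Y₁ Y₂}
    {S : E.Sq (E.hcomp A P') (E.hcomp P B)} {T : E.Sq (E.hcomp B Q') (E.hcomp Q C)}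
    {hS : E.right S = 𝟙 _} {hT : E.left T = 𝟙 _}
    (α : E.Sq a A) (β : E.Sq b B) (γ : E.Sq c C) (μ : E.Sq p P) (ν : E.Sq q Q)
    (μ' : E.Sq p' P') (ν' : E.Sq q' Q')
    (h₁ : E.right α = E.left μ') (h₂ : E.right μ = E.left β) (h₃ : E.right β = E.left ν')
    (h₄ : E.right ν = E.left γ) (h₅ : E.right μ' = E.left ν') (h₆ : E.right μ = E.left ν)
    (e₁ : E.hsq α μ' h₁ ≫ S = s ≫ E.hsq μ β h₂)
    (e₂ : E.hsq β ν' h₃ ≫ T = t ≫ E.hsq ν γ h₄) :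
    E.hsq α (E.hsq μ' ν' h₅) (by simp [h₁]) ≫ paste S T hS hT =
      paste s t hs ht ≫ E.hsq (E.hsq μ ν h₆) γ (by simp [h₄]) := by
  unfold paste
  simp only [Category.assoc]
  rw [assoc_inv_naturality_assoc _ _ _ h₁ h₅, hsq_hsq_assoc,
    hsq_congr _ e₁ ((Category.comp_id _).trans (Category.id_comp _).symm),
    ← hsq_hsq_assoc s (E.one _) (by simp [hs]) (E.hsq μ β h₂) ν' (by simp [h₃]),
    E.assoc_naturality_assoc _ _ _ h₂ h₃, hsq_hsq_assoc,
    hsq_congr _ ((Category.comp_id _).trans (Category.id_comp _).symm) e₂,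
    ← hsq_hsq_assoc (E.one _) t (by simp [ht]) μ (E.hsq ν γ h₄) (by simp [h₆]),
    assoc_inv_naturality _ _ _ h₆ h₄]

lemma idSq_naturality {x y x' y' : E.Obj} {m : E.Pro x y} {m' : E.Pro x' y'} (α : E.Sq m m')
    {f : x ⟶ x'} {g : y ⟶ y'} (hf : E.left α = f) (hg : E.right α = g) :
    E.hsq α (E.hidSq g) (by simp [hg]) ≫ (E.runit m').hom ≫ (E.lunit m').inv =
      ((E.runit m).hom ≫ (E.lunit m).inv) ≫ E.hsq (E.hidSq f) α (by simp [hf]) := by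
  subst hf hg
  rw [runit_naturality'_assoc α rfl, lunit_inv_naturality, Category.assoc]

/-- The identity protransformation. -/
def id (F : LaxDoubleFunctor D E) : OplaxProtrans F F where
  app x := E.hid (F.obj x)
  sq f := E.hidSq (F.map f)
  left_sq f := by simp
  right_sq f := by simp
  nat m := (E.runit (F.pro m)).hom ≫ (E.lunit (F.pro m)).inv
  left_nat m := by simp
  right_nat m := by simp
  sq_id x := by simp
  sq_comp f g := by simp [hidSq_comp]
  naturality γ := idSq_naturality (F.sq γ) (F.left_sq γ) (F.right_sq γ)
  nat_hcomp m n := congrArg Glob.sq ((Lax.OplaxTrans.id F.toHor).naturality_comp (a := ⟨_⟩)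
    (b := ⟨_⟩) (c := ⟨_⟩) m n)
  nat_hid x := congrArg Glob.sq ((Lax.OplaxTrans.id F.toHor).naturality_id ⟨x⟩)

/-- The composite of protransformations. -/
def comp {F G H : LaxDoubleFunctor D E} (σ : OplaxProtrans F G) (τ : OplaxProtrans G H) :
    OplaxProtrans F H where
  app x := E.hcomp (σ.app x) (τ.app x)
  sq f := E.hsq (σ.sq f) (τ.sq f) (by simp)
  left_sq f := by simp
  right_sq f := by simp
  nat m := paste (σ.nat m) (τ.nat m) (by simp) (by simp)
  left_nat m := by simp [paste]
  right_nat m := by simp [paste]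
  sq_id x := hsq_eq_one _ (σ.sq_id x) (τ.sq_id x)
  sq_comp f g := by rw [hsq_hsq]; exact hsq_congr _ (σ.sq_comp f g) (τ.sq_comp f g)
  naturality γ := paste_naturality _ _ _ _ _ _ _ _ _ _ _ _ _ (σ.naturality γ) (τ.naturality γ)
  nat_hcomp m n := congrArg Glob.sq
    (Lax.OplaxTrans.vComp_naturality_comp σ.toHor τ.toHor (a := ⟨_⟩) (b := ⟨_⟩) (c := ⟨_⟩) m n)
  nat_hid x := congrArg Glob.sq
    (Lax.OplaxTrans.vComp_naturality_id σ.toHor τ.toHor ⟨x⟩)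

end OplaxProtrans

/-- A modification bounded by oplax protransformations and natural transformations. -/
@[ext]
structure Modification {F G H K : LaxDoubleFunctor D E} (σ : OplaxProtrans F G)
    (τ : OplaxProtrans H K) where
  left : F ⟶ H
  right : G ⟶ K
  app (x : D.Obj) : E.Sq (σ.app x) (τ.app x)
  left_app (x : D.Obj) : E.left (app x) = left.app x
  right_app (x : D.Obj) : E.right (app x) = right.app x
  /-- internal equivariance -/
  internal {x y : D.Obj} (f : x ⟶ y) : app x ≫ τ.sq f = σ.sq f ≫ app y
  /-- external equivariance -/
  external {x y : D.Obj} (m : D.Pro x y) :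
    E.hsq (left.sq m) (app y) ((left.right_sq m).trans (left_app y).symm) ≫ τ.nat m =
      σ.nat m ≫ E.hsq (app x) (right.sq m) ((right_app x).trans (right.left_sq m).symm)

instance (D : DoubleCategory.{u₁, v₁, w₁, t₁}) (E : DoubleCategory.{u₂, v₂, w₂, t₂}) :
    Category (ProObj (OplaxProtrans (D := D) (E := E))) where
  Hom σ τ := Modification σ.pro τ.pro
  id σ :=
    { left := 𝟙 σ.src
      right := 𝟙 σ.tgt
      app x := E.one (σ.pro.app x)
      left_app x := by simp
      right_app x := by simp
      internal f := by simp
      external m := by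
        rw [hsq_eq_one _ (LaxDoubleFunctor.id_sq _ m) rfl, Category.id_comp,
          hsq_eq_one _ rfl (LaxDoubleFunctor.id_sq _ m), Category.comp_id] }
  comp {σ τ υ} μ ν :=
    { left := μ.left ≫ ν.left
      right := μ.right ≫ ν.right
      app x := μ.app x ≫ ν.app x
      left_app x := by simp [μ.left_app, ν.left_app]
      right_app x := by simp [μ.right_app, ν.right_app]
      internal f := by
        rw [Category.assoc, ν.internal, ← Category.assoc, μ.internal, Category.assoc]
      external m := by
        have h := hsq_hsq (X := E) _ _ ((μ.left.right_sq m).trans (μ.left_app _).symm) _ _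
          ((ν.left.right_sq m).trans (ν.left_app _).symm)
        have h' := hsq_hsq (X := E) _ _ ((μ.right_app _).trans (μ.right.left_sq m).symm) _ _
          ((ν.right_app _).trans (ν.right.left_sq m).symm)
        refine (congrArg (· ≫ _) h.symm).trans (Eq.trans ?_ (congrArg (_ ≫ ·) h'))
        simp only [Category.assoc]
        rw [ν.external, ← Category.assoc, μ.external, Category.assoc] }
  id_comp μ := Modification.ext (Category.id_comp _) (Category.id_comp _)
    (by funext x; exact Category.id_comp (μ.app x))
  comp_id μ := Modification.ext (Category.comp_id _) (Category.comp_id _)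
    (by funext x; exact Category.comp_id (μ.app x))
  assoc μ ν ξ := Modification.ext (Category.assoc _ _ _) (Category.assoc _ _ _)
    (by funext x; exact Category.assoc (μ.app x) (ν.app x) (ξ.app x))

namespace Modification

variable {F G H : LaxDoubleFunctor D E}

lemma congr_app {σ τ : ProObj (OplaxProtrans (D := D) (E := E))} {μ ν : σ ⟶ τ} (h : μ = ν)
    (x : D.Obj) : Modification.app μ x = Modification.app ν x := by rw [h]

/-- The external identity modification on a natural transformation. -/
def hid (α : F ⟶ G) : Modification (OplaxProtrans.id F) (OplaxProtrans.id G) where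
  left := α
  right := α
  app x := E.hidSq (α.app x)
  left_app x := E.left_hidSq _
  right_app x := E.right_hidSq _
  internal f := by
    change E.hidSq _ ≫ E.hidSq _ = E.hidSq _ ≫ E.hidSq _
    rw [← hidSq_comp, ← hidSq_comp, α.naturality]
  external m := OplaxProtrans.idSq_naturality (α.sq m) (α.left_sq m) (α.right_sq m)

/-- External composition of modifications. -/
def hcomp {F' G' H' : LaxDoubleFunctor D E} {σ : OplaxProtrans F G} {τ : OplaxProtrans G H}
    {σ' : OplaxProtrans F' G'} {τ' : OplaxProtrans G' H'} (μ : Modification σ σ')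
    (ν : Modification τ τ') (h : μ.right = ν.left) : Modification (σ.comp τ) (σ'.comp τ') where
  left := μ.left
  right := ν.right
  app x := E.hsq (μ.app x) (ν.app x) (by rw [μ.right_app, ν.left_app, h])
  left_app x := (E.left_hsq _ _ _).trans (μ.left_app x)
  right_app x := (E.right_hsq _ _ _).trans (ν.right_app x)
  internal f := by
    change E.hsq _ _ _ ≫ E.hsq _ _ _ = E.hsq _ _ _ ≫ E.hsq _ _ _
    rw [hsq_hsq, hsq_hsq]
    exact hsq_congr _ (μ.internal f) (ν.internal f)
  external m := by
    have aux : ∀ (β : G ⟶ G') (hβ : ν.left = β),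
        E.hsq (β.sq m) (ν.app _) ((β.right_sq m).trans (by rw [ν.left_app, hβ])) ≫ τ'.nat m =
          τ.nat m ≫ E.hsq (ν.app _) (ν.right.sq m)
            ((ν.right_app _).trans (ν.right.left_sq m).symm) := by
      rintro _ rfl; exact ν.external m
    exact OplaxProtrans.paste_naturality (hs := σ.right_nat m) (ht := τ.left_nat m)
      (hS := σ'.right_nat m) (hT := τ'.left_nat m) _ _ _ _ _ _ _ _ _ _ _ _ _ (μ.external m) (aux _ h.symm)

/-- A family of globular cells satisfying the equivariance axioms. -/
def ofGlob {σ τ : OplaxProtrans F G} (e : ∀ x, Glob (σ.app x) (τ.app x))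
    (h₁ : ∀ {x y : D.Obj} (f : x ⟶ y), (e x).sq ≫ τ.sq f = σ.sq f ≫ (e y).sq)
    (h₂ : ∀ {x y : D.Obj} (m : D.Pro x y),
      E.hsq (E.one (F.pro m)) (e y).sq (by simp) ≫ τ.nat m =
        σ.nat m ≫ E.hsq (e x).sq (E.one (G.pro m)) (by simp)) : Modification σ τ where
  left := 𝟙 F
  right := 𝟙 G
  app x := (e x).sq
  left_app x := (e x).left
  right_app x := (e x).right
  internal := h₁
  external := h₂

/-- Invertible globular modifications. -/
def isoOfGlob {σ τ : OplaxProtrans F G} (e : ∀ x, σ.app x ≅ τ.app x)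
    (h₁ : ∀ {x y : D.Obj} (f : x ⟶ y), (e x).hom.sq ≫ τ.sq f = σ.sq f ≫ (e y).hom.sq)
    (h₂ : ∀ {x y : D.Obj} (m : D.Pro x y),
      E.hsq (E.one (F.pro m)) (e y).hom.sq (by simp) ≫ τ.nat m =
        σ.nat m ≫ E.hsq (e x).hom.sq (E.one (G.pro m)) (by simp)) :
    ProObj.mk (Pro := OplaxProtrans (D := D) (E := E)) σ ≅ ProObj.mk τ where
  hom := ofGlob (fun x => (e x).hom) h₁ h₂
  inv := ofGlob (fun x => (e x).inv)
    (fun {x y} f => by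
      have hx := congrArg Glob.sq (e x).inv_hom_id
      have hy := congrArg Glob.sq (e y).hom_inv_id
      change (e x).inv.sq ≫ (e x).hom.sq = 𝟙 _ at hx
      change (e y).hom.sq ≫ (e y).inv.sq = 𝟙 _ at hy
      rw [← Category.comp_id (_ ≫ σ.sq f), ← hy, Category.assoc, ← Category.assoc (σ.sq f),
        ← h₁, Category.assoc, ← Category.assoc, hx, Category.id_comp])
    (fun {x y} m => by
      have hx := congrArg Glob.sq (e x).hom_inv_id
      have hy := congrArg Glob.sq (e y).inv_hom_id
      change (e x).hom.sq ≫ (e x).inv.sq = 𝟙 _ at hx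
      change (e y).inv.sq ≫ (e y).hom.sq = 𝟙 _ at hy
      have h : E.hsq (e x).hom.sq (E.one (G.pro m)) (by simp) ≫
          E.hsq (e x).inv.sq (E.one (G.pro m)) (by simp) = 𝟙 _ := by
        rw [hsq_hsq]; exact hsq_eq_one _ hx (Category.comp_id _)
      have h' : E.hsq (E.one (F.pro m)) (e y).inv.sq (by simp) ≫
          E.hsq (E.one (F.pro m)) (e y).hom.sq (by simp) = 𝟙 _ := by
        rw [hsq_hsq]; exact hsq_eq_one _ (Category.comp_id _) hy
      rw [← Category.comp_id (_ ≫ σ.nat m), ← h, Category.assoc, ← Category.assoc (σ.nat m),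
        ← h₂, Category.assoc, ← Category.assoc, h', Category.id_comp])
  hom_inv_id := Modification.ext (Category.comp_id (𝟙 F)) (Category.comp_id (𝟙 G))
    (by funext x; exact congrArg Glob.sq (e x).hom_inv_id)
  inv_hom_id := Modification.ext (Category.comp_id (𝟙 F)) (Category.comp_id (𝟙 G))
    (by funext x; exact congrArg Glob.sq (e x).inv_hom_id)

end Modification

open scoped Lax.OplaxTrans in
/-- The double category of lax double functors, natural transformations, oplax protransformations
and modifications. -/
def LaxOpl (D : DoubleCategory.{u₁, v₁, w₁, t₁}) (E : DoubleCategory.{u₂, v₂, w₂, t₂}) :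
    DoubleCategory where
  Obj := LaxDoubleFunctor D E
  Pro F G := OplaxProtrans F G
  left μ := Modification.left μ
  right μ := Modification.right μ
  left_one _ := rfl
  right_one _ := rfl
  left_comp _ _ := rfl
  right_comp _ _ := rfl
  hid F := OplaxProtrans.id F
  hidSq α := Modification.hid α
  left_hidSq _ := rfl
  right_hidSq _ := rfl
  hidSq_id F := Modification.ext rfl rfl (by funext x; exact E.hidSq_id _)
  hidSq_comp α β := Modification.ext rfl rfl (by funext x; exact E.hidSq_comp _ _)
  hcomp σ τ := σ.comp τ
  hsq μ ν h := Modification.hcomp μ ν h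
  left_hsq _ _ _ := rfl
  right_hsq _ _ _ := rfl
  hsq_one σ τ := Modification.ext rfl rfl (by funext x; exact E.hsq_one (σ.app x) (τ.app x))
  hsq_comp μ ν h μ' ν' h' := Modification.ext rfl rfl (by
    funext x
    exact E.hsq_comp (Modification.app μ x) (Modification.app ν x) _ (Modification.app μ' x)
      (Modification.app ν' x) _)
  assoc σ τ υ := Modification.isoOfGlob
    (fun x => Bicategory.associator (B := Hor E) (a := ⟨_⟩) (b := ⟨_⟩) (c := ⟨_⟩) (d := ⟨_⟩)
      (σ.app x) (τ.app x) (υ.app x))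
    (fun f => (E.assoc_naturality _ _ _ _ _).symm)
    (fun {x y} m => congrArg Glob.sq ((Lax.OplaxTrans.associator σ.toHor τ.toHor
      υ.toHor).hom.as.naturality (a := ⟨x⟩) (b := ⟨y⟩) m))
  left_assoc _ _ _ := rfl
  right_assoc _ _ _ := rfl
  assoc_naturality μ ν ξ h h' := Modification.ext
    ((Category.comp_id _).trans (Category.id_comp _).symm)
    ((Category.comp_id _).trans (Category.id_comp _).symm)
    (by
      funext x
      exact E.assoc_naturality (Modification.app μ x) (Modification.app ν x)
        (Modification.app ξ x) _ _)
  lunit {F G} σ := Modification.isoOfGlob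
    (fun x => Bicategory.leftUnitor (B := Hor E) (a := ⟨_⟩) (b := ⟨_⟩) (σ.app x))
    (fun f => (lunit_naturality' _ (σ.left_sq f)).symm)
    (fun {x y} m => congrArg Glob.sq ((Lax.OplaxTrans.leftUnitor
      σ.toHor).hom.as.naturality (a := ⟨x⟩) (b := ⟨y⟩) m))
  left_lunit _ := rfl
  right_lunit _ := rfl
  lunit_naturality μ := Modification.ext
    ((Category.comp_id _).trans (Category.id_comp _).symm)
    ((Category.comp_id _).trans (Category.id_comp _).symm)
    (by funext x; exact lunit_naturality' (Modification.app μ x) (Modification.left_app μ x))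
  runit {F G} σ := Modification.isoOfGlob
    (fun x => Bicategory.rightUnitor (B := Hor E) (a := ⟨_⟩) (b := ⟨_⟩) (σ.app x))
    (fun f => (runit_naturality' _ (σ.right_sq f)).symm)
    (fun {x y} m => congrArg Glob.sq ((Lax.OplaxTrans.rightUnitor
      σ.toHor).hom.as.naturality (a := ⟨x⟩) (b := ⟨y⟩) m))
  left_runit _ := rfl
  right_runit _ := rfl
  runit_naturality μ := Modification.ext
    ((Category.comp_id _).trans (Category.id_comp _).symm)
    ((Category.comp_id _).trans (Category.id_comp _).symm)
    (by funext x; exact runit_naturality' (Modification.app μ x) (Modification.right_app μ x))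
  pentagon σ τ υ φ := Modification.ext
    (Category.id_comp ((𝟙 _ : (_ : LaxDoubleFunctor D E) ⟶ _) ≫ 𝟙 _))
    (Category.id_comp ((𝟙 _ : (_ : LaxDoubleFunctor D E) ⟶ _) ≫ 𝟙 _)) (by funext x; exact E.pentagon (σ.app x) (τ.app x) (υ.app x) (φ.app x))
  triangle σ τ := Modification.ext (Category.id_comp _) (Category.id_comp _)
    (by funext x; exact E.triangle (σ.app x) (τ.app x))

lemma isIso_hsq {X : DoubleCategory.{u, v, w, t}} {x y z x' y' z' : X.Obj} {m : X.Pro x y}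
    {n : X.Pro y z} {m' : X.Pro x' y'} {n' : X.Pro y' z'} (α : X.Sq m m') (β : X.Sq n n')
    (h : X.right α = X.left β) [IsIso α] [IsIso β] : IsIso (X.hsq α β h) := by
  have h' : X.right (inv α) = X.left (inv β) := by
    have h₁ : X.left β ≫ X.left (inv β) = 𝟙 _ := by
      rw [← left_comp, IsIso.hom_inv_id, left_one]
    rw [← Category.comp_id (X.right (inv α)), ← h₁, ← h, ← Category.assoc, right_isIso_inv,
      Category.id_comp]
  exact ⟨X.hsq (inv α) (inv β) h', by rw [hsq_hsq]; exact hsq_eq_one _ (by simp) (by simp),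
    by rw [hsq_hsq]; exact hsq_eq_one _ (by simp) (by simp)⟩

instance (X : DoubleCategory.{u, v, w, t}) (K : ∀ ⦃x y : X.Obj⦄, X.Pro x y → Prop) :
    Category (ProObj fun x y : X.Obj => {m : X.Pro x y // K m}) where
  Hom m n := X.Sq m.pro.1 n.pro.1
  id m := X.one m.pro.1
  comp α β := α ≫ β
  id_comp α := Category.id_comp (X := ProObj.mk _) α
  comp_id α := Category.comp_id (Y := ProObj.mk _) α
  assoc α β γ := Category.assoc (W := ProObj.mk _) (X := ProObj.mk _) α β γ

/-- The double category obtained by keeping only some of the proarrows. -/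
def restrictPro (X : DoubleCategory.{u, v, w, t}) (K : ∀ ⦃x y : X.Obj⦄, X.Pro x y → Prop)
    (hK : ∀ x, K (X.hid x))
    (hK' : ∀ ⦃x y z⦄ (m : X.Pro x y) (n : X.Pro y z), K m → K n → K (X.hcomp m n)) :
    DoubleCategory.{u, v, w, t} where
  Obj := X.Obj
  Pro x y := {m : X.Pro x y // K m}
  left {m n} α := X.left (m := ProObj.mk m.pro.1) (n := ProObj.mk n.pro.1) α
  right {m n} α := X.right (m := ProObj.mk m.pro.1) (n := ProObj.mk n.pro.1) α
  left_one _ := X.left_one _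
  right_one _ := X.right_one _
  left_comp _ _ := X.left_comp _ _
  right_comp _ _ := X.right_comp _ _
  hid x := ⟨X.hid x, hK x⟩
  hidSq f := X.hidSq f
  left_hidSq _ := X.left_hidSq _
  right_hidSq _ := X.right_hidSq _
  hidSq_id _ := X.hidSq_id _
  hidSq_comp _ _ := X.hidSq_comp _ _
  hcomp m n := ⟨X.hcomp m.1 n.1, hK' m.1 n.1 m.2 n.2⟩
  hsq α β h := X.hsq α β h
  left_hsq _ _ _ := X.left_hsq _ _ _
  right_hsq _ _ _ := X.right_hsq _ _ _
  hsq_one m n := X.hsq_one m.1 n.1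
  hsq_comp α β h α' β' h' := X.hsq_comp α β h α' β' h'
  assoc m n p :=
    { hom := (X.assoc m.1 n.1 p.1).hom
      inv := (X.assoc m.1 n.1 p.1).inv
      hom_inv_id := (X.assoc m.1 n.1 p.1).hom_inv_id
      inv_hom_id := (X.assoc m.1 n.1 p.1).inv_hom_id }
  left_assoc _ _ _ := X.left_assoc _ _ _
  right_assoc _ _ _ := X.right_assoc _ _ _
  assoc_naturality α β γ h h' := X.assoc_naturality α β γ h h'
  lunit m :=
    { hom := (X.lunit m.1).hom
      inv := (X.lunit m.1).inv
      hom_inv_id := (X.lunit m.1).hom_inv_id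
      inv_hom_id := (X.lunit m.1).inv_hom_id }
  left_lunit _ := X.left_lunit _
  right_lunit _ := X.right_lunit _
  lunit_naturality α := X.lunit_naturality α
  runit m :=
    { hom := (X.runit m.1).hom
      inv := (X.runit m.1).inv
      hom_inv_id := (X.runit m.1).hom_inv_id
      inv_hom_id := (X.runit m.1).inv_hom_id }
  left_runit _ := X.left_runit _
  right_runit _ := X.right_runit _
  runit_naturality α := X.runit_naturality α
  pentagon m n p q := X.pentagon m.1 n.1 p.1 q.1
  triangle m n := X.triangle m.1 n.1

/-- A protransformation is pseudo if its naturality comparisons are invertible. -/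
def OplaxProtrans.IsPseudo {F G : LaxDoubleFunctor D E} (σ : OplaxProtrans F G) : Prop :=
  ∀ ⦃x y : D.Obj⦄ (m : D.Pro x y), IsIso (σ.nat m)

lemma OplaxProtrans.isIso_paste {x₀ x₁ x₂ y₀ y₁ y₂ : E.Obj} {a : E.Pro x₀ y₀} {b : E.Pro x₁ y₁}
    {c : E.Pro x₂ y₂} {p : E.Pro x₀ x₁} {q : E.Pro x₁ x₂} {p' : E.Pro y₀ y₁} {q' : E.Pro y₁ y₂}
    (s : E.Sq (E.hcomp a p') (E.hcomp p b)) (t : E.Sq (E.hcomp b q') (E.hcomp q c))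
    (hs : E.right s = 𝟙 _) (ht : E.left t = 𝟙 _) [IsIso s] [IsIso t] :
    IsIso (paste s t hs ht) := by
  have := isIso_hsq s (E.one q') (by simp [hs])
  have := isIso_hsq (E.one p) t (by simp [ht])
  unfold paste
  infer_instance

/-- The double category of lax double functors, natural transformations, pseudo protransformations
and modifications. -/
def LaxPs (D : DoubleCategory.{u₁, v₁, w₁, t₁}) (E : DoubleCategory.{u₂, v₂, w₂, t₂}) :
    DoubleCategory :=
  (LaxOpl D E).restrictPro
    (fun (F G : LaxDoubleFunctor D E) (σ : OplaxProtrans F G) => σ.IsPseudo)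
    (fun (F : LaxDoubleFunctor D E) x y m => by
      change IsIso ((E.runit (F.pro m)).hom ≫ (E.lunit (F.pro m)).inv)
      infer_instance)
    (fun (F G H : LaxDoubleFunctor D E) (σ : OplaxProtrans F G) (τ : OplaxProtrans G H)
        hσ hτ x y m => by
      have := hσ m
      have := hτ m
      exact OplaxProtrans.isIso_paste (σ.nat m) (τ.nat m) (σ.right_nat m) (τ.left_nat m))

section companions

variable {X : DoubleCategory.{u, v, w, t}}

/-- A companion of an arrow: a proarrow with unit and counit binding cells. -/
structure Companion {x y : X.Obj} (f : x ⟶ y) where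
  pro : X.Pro x y
  unit : X.Sq (X.hid x) pro
  counit : X.Sq pro (X.hid y)
  left_unit : X.left unit = 𝟙 x
  right_unit : X.right unit = f
  left_counit : X.left counit = f
  right_counit : X.right counit = 𝟙 y
  unit_counit : unit ≫ counit = X.hidSq f
  hsq_unit_counit :
    (X.lunit pro).inv ≫ X.hsq unit counit (right_unit.trans left_counit.symm) ≫
      (X.runit pro).hom = X.one pro

attribute [simp] Companion.left_unit Companion.right_unit Companion.left_counit
  Companion.right_counit

/-- The globular cell `m ⊙ g_! ⟶ f_! ⊙ n` obtained from a cell `α` with boundary arrows `f`, `g` by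
sliding these arrows into chosen companions. -/
def slide {x y x' y' : X.Obj} {m : X.Pro x y} {n : X.Pro x' y'} {f : x ⟶ x'} {g : y ⟶ y'}
    (cf : Companion f) (cg : Companion g) (α : X.Sq m n) (hf : X.left α = f)
    (hg : X.right α = g) : X.Sq (X.hcomp m cg.pro) (X.hcomp cf.pro n) :=
  (X.lunit _).inv ≫ X.hsq cf.unit (X.hsq α cg.counit (by simp [hg])) (by simp [hf]) ≫
    X.hsq (X.one cf.pro) (X.runit n).hom (by simp)

/-- A cell is a commuter if its boundary arrows have companions and the globular cell obtained by
sliding is invertible (this does not depend on the companions). -/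
def IsCommuter {x y x' y' : X.Obj} {m : X.Pro x y} {n : X.Pro x' y'} (α : X.Sq m n) : Prop :=
  ∃ (cf : Companion (X.left α)) (cg : Companion (X.right α)), IsIso (slide cf cg α rfl rfl)

lemma unitors_hid (x : X.Obj) : (X.lunit (X.hid x)).hom = (X.runit (X.hid x)).hom :=
  congrArg Glob.sq (Bicategory.unitors_equal (B := Hor X) (a := ⟨x⟩))

lemma unitors_inv_hid (x : X.Obj) : (X.lunit (X.hid x)).inv = (X.runit (X.hid x)).inv :=
  congrArg Glob.sq (Bicategory.unitors_inv_equal (B := Hor X) (a := ⟨x⟩))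

/-- The identity companion. -/
def Companion.id (x : X.Obj) : Companion (𝟙 x) where
  pro := X.hid x
  unit := X.one _
  counit := X.one _
  left_unit := by simp
  right_unit := by simp
  left_counit := by simp
  right_counit := by simp
  unit_counit := by simp
  hsq_unit_counit := by simp [← unitors_hid]

lemma slide_id {x y : X.Obj} (m : X.Pro x y) :
    IsIso (slide (Companion.id x) (Companion.id y) (X.one m) (by simp) (by simp)) := by
  have := isIso_hsq (X.one (X.hid x)) (X.runit m).hom (by simp)
  have h : X.hsq (X.one (X.hid x)) (X.hsq (X.one m) (X.one (X.hid y)) (by simp)) (by simp) = 𝟙 _ :=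
    hsq_eq_one _ rfl (hsq_eq_one _ rfl rfl)
  have : IsIso (X.hsq (X.one (X.hid x)) (X.hsq (X.one m) (X.one (X.hid y)) (by simp))
    (by simp)) := by rw [h]; infer_instance
  change IsIso ((X.lunit _).inv ≫ X.hsq (X.one _) (X.hsq (X.one m) (X.one _) _) _ ≫
    X.hsq (X.one _) (X.runit m).hom _)
  infer_instance

lemma lunit_hcomp {x y z : X.Obj} (m : X.Pro x y) (n : X.Pro y z) :
    (X.assoc (X.hid x) m n).inv ≫ X.hsq (X.lunit m).hom (X.one n) (by simp) =
      (X.lunit (X.hcomp m n)).hom :=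
  (congrArg Glob.sq (Bicategory.leftUnitor_comp (B := Hor X) (a := ⟨x⟩) (b := ⟨y⟩) (c := ⟨z⟩)
    m n)).symm

lemma lunit_inv_hcomp {x y z : X.Obj} (m : X.Pro x y) (n : X.Pro y z) :
    (X.lunit (X.hcomp m n)).inv ≫ (X.assoc (X.hid x) m n).inv =
      X.hsq (X.lunit m).inv (X.one n) (by simp) := by
  have h : X.hsq (X.lunit m).inv (X.one n) (by simp) ≫
      X.hsq (X.lunit m).hom (X.one n) (by simp) = 𝟙 _ := by
    rw [hsq_hsq]; exact hsq_eq_one _ (by simp) (by simp)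
  have := isIso_hsq (X.lunit m).hom (X.one n) (by simp)
  rw [← cancel_mono (X.hsq (X.lunit m).hom (X.one n) (by simp)), h, Category.assoc, lunit_hcomp,
    Iso.inv_hom_id]

lemma runit_hcomp {x y z : X.Obj} (m : X.Pro x y) (n : X.Pro y z) :
    (X.assoc m n (X.hid z)).inv ≫ (X.runit (X.hcomp m n)).hom =
      X.hsq (X.one m) (X.runit n).hom (by simp) := by
  rw [Iso.inv_comp_eq]
  exact congrArg Glob.sq (Bicategory.rightUnitor_comp (B := Hor X) (a := ⟨x⟩) (b := ⟨y⟩)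
    (c := ⟨z⟩) m n)

/-- Composition of companions. -/
def Companion.comp {x y z : X.Obj} {f : x ⟶ y} {g : y ⟶ z} (cf : Companion f)
    (cg : Companion g) : Companion (f ≫ g) where
  pro := X.hcomp cf.pro cg.pro
  unit := cf.unit ≫ (X.runit cf.pro).inv ≫ X.hsq (X.one cf.pro) cg.unit (by simp)
  counit := X.hsq cf.counit (X.one cg.pro) (by simp) ≫ (X.lunit cg.pro).hom ≫ cg.counit
  left_unit := by simp
  right_unit := by simp
  left_counit := by simp
  right_counit := by simp
  unit_counit := by
    have h : X.hsq (X.one cf.pro) cg.unit (by simp) ≫ X.hsq cf.counit (X.one cg.pro) (by simp) =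
        X.hsq cf.counit (X.hidSq (𝟙 _)) (by simp) ≫ X.hsq (X.hidSq (𝟙 _)) cg.unit (by simp) := by
      rw [hsq_hsq, hsq_hsq]; exact hsq_congr _ (by simp) (by simp)
    simp only [Category.assoc]
    rw [← Category.assoc (X.hsq (X.one cf.pro) cg.unit _), h, Category.assoc,
      lunit_naturality'_assoc cg.unit cg.left_unit, unitors_hid,
      runit_naturality'_assoc cf.counit cf.right_counit, Iso.inv_hom_id_assoc, cg.unit_counit,
      ← Category.assoc, cf.unit_counit, hidSq_comp]
  hsq_unit_counit := by
    have e₁ : X.hsq (cf.unit ≫ (X.runit cf.pro).inv ≫ X.hsq (X.one cf.pro) cg.unit (by simp))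
        (X.hsq cf.counit (X.one cg.pro) (by simp) ≫ (X.lunit cg.pro).hom ≫ cg.counit) (by simp) =
        X.hsq cf.unit (X.hsq cf.counit (X.one cg.pro) (by simp)) (by simp) ≫
          X.hsq (X.runit cf.pro).inv (X.lunit cg.pro).hom (by simp) ≫
          X.hsq (X.hsq (X.one cf.pro) cg.unit (by simp)) cg.counit (by simp) := by
      rw [hsq_hsq, hsq_hsq]
    have e₂ : (X.lunit (X.hcomp cf.pro cg.pro)).inv ≫
        X.hsq cf.unit (X.hsq cf.counit (X.one cg.pro) (by simp)) (by simp) =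
        X.hsq (X.runit cf.pro).inv (X.one cg.pro) (by simp) ≫ (X.assoc _ _ _).hom := by
      rw [← cancel_mono (X.assoc _ _ _).inv, Category.assoc, Category.assoc, Iso.hom_inv_id,
        Category.comp_id, assoc_inv_naturality _ _ _ (by simp) (by simp), ← Category.assoc,
        lunit_inv_hcomp, hsq_hsq]
      refine hsq_congr _ ?_ (Category.comp_id _)
      rw [← cancel_mono (X.runit cf.pro).hom, Iso.inv_hom_id, Category.assoc]
      exact cf.hsq_unit_counit
    have e₃ : X.hsq (X.hsq (X.one cf.pro) cg.unit (by simp)) cg.counit (by simp) ≫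
        (X.runit (X.hcomp cf.pro cg.pro)).hom =
        (X.assoc _ _ _).hom ≫ X.hsq (X.one cf.pro) (X.lunit cg.pro).hom (by simp) := by
      rw [← Iso.inv_comp_eq, ← assoc_inv_naturality_assoc _ _ _ (by simp) (by simp), runit_hcomp,
        hsq_hsq]
      refine hsq_congr _ (Category.comp_id _) ?_
      rw [← cancel_epi (X.lunit cg.pro).inv, Iso.inv_hom_id]
      exact cg.hsq_unit_counit
    rw [e₁]
    simp only [Category.assoc]
    rw [e₃, ← Category.assoc, e₂, X.triangle, hsq_hsq, Category.assoc,
      hsq_congr _ (Iso.inv_hom_id _) (Category.comp_id _), X.triangle, hsq_hsq]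
    exact hsq_eq_one _ (Iso.inv_hom_id _) (Category.comp_id _)

lemma Companion.comp_unit {x y z : X.Obj} {f : x ⟶ y} {g : y ⟶ z} (cf : Companion f)
    (cg : Companion g) : (cf.comp cg).unit =
      (X.lunit (X.hid x)).inv ≫ X.hsq cf.unit (X.hidSq f ≫ cg.unit) (by simp) := by
  change cf.unit ≫ (X.runit cf.pro).inv ≫ X.hsq (X.one cf.pro) cg.unit _ = _
  rw [runit_inv_naturality_assoc, hsq_hsq, unitors_inv_hid]
  congr 1
  exact hsq_congr _ (Category.comp_id _) (by simp)

lemma unit_slide {x y x' y' : X.Obj} {m : X.Pro x y} {n : X.Pro x' y'} {f : x ⟶ x'} {g : y ⟶ y'}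
    (cf : Companion f) (cg : Companion g) (α : X.Sq m n) (hf : X.left α = f)
    (hg : X.right α = g) :
    X.hsq (X.one m) cg.unit (by simp) ≫ slide cf cg α hf hg =
      ((X.runit m).hom ≫ (X.lunit m).inv) ≫ X.hsq cf.unit α (by simp [hf]) := by
  unfold slide
  have e : X.hsq α (X.hidSq g) (by simp [hg]) ≫ (X.runit n).hom = (X.runit m).hom ≫ α :=
    runit_naturality' α hg
  rw [lunit_inv_naturality_assoc, hsq_hsq, hsq_hsq, Category.assoc,
    lunit_inv_naturality_assoc (X.runit m).hom, hsq_hsq]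
  congr 1
  refine hsq_congr _ ?_ ?_
  · simp
  · rw [← Category.assoc, hsq_hsq, hsq_congr _ (Category.id_comp α) cg.unit_counit, e]

lemma eq_slide {x y x' y' : X.Obj} {m : X.Pro x y} {n : X.Pro x' y'} {f : x ⟶ x'} {g : y ⟶ y'}
    (cf : Companion f) (cg : Companion g) (α : X.Sq m n) (hf : X.left α = f)
    (hg : X.right α = g) (β : X.Sq (X.hcomp m cg.pro) (X.hcomp cf.pro n)) (hβ : X.right β = 𝟙 _)
    (h : X.hsq (X.one m) cg.unit (by simp) ≫ β =
      ((X.runit m).hom ≫ (X.lunit m).inv) ≫ X.hsq cf.unit α (by simp [hf])) :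
    β = slide cf cg α hf hg := by
  have e₁ : X.hsq (X.one m) (X.lunit cg.pro).inv (by simp) ≫
      X.hsq (X.one m) (X.hsq cg.unit cg.counit (by simp)) (by simp) ≫
      X.hsq (X.one m) (X.runit cg.pro).hom (by simp) = 𝟙 _ := by
    rw [hsq_hsq, hsq_hsq]
    exact hsq_eq_one _ (by simp) cg.hsq_unit_counit
  have e₂ : X.hsq (X.hsq (X.one m) cg.unit (by simp)) cg.counit (by simp) ≫
      X.hsq β (X.hidSq (𝟙 _)) (by simp [hβ]) =
      X.hsq ((X.runit m).hom ≫ (X.lunit m).inv) (X.one _) (by simp) ≫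
        X.hsq (X.hsq cf.unit α (by simp [hf])) cg.counit (by simp [hg]) := by
    rw [hsq_hsq, hsq_hsq]
    exact hsq_congr _ h (by simp)
  have e₃ : X.hsq (X.one m) (X.lunit cg.pro).inv (by simp) ≫ (X.assoc _ _ _).inv ≫
      X.hsq ((X.runit m).hom ≫ (X.lunit m).inv) (X.one cg.pro) (by simp) =
      (X.lunit _).inv ≫ (X.assoc _ _ _).inv := by
    rw [lunit_inv_hcomp]
    have : X.hsq ((X.runit m).hom ≫ (X.lunit m).inv) (X.one cg.pro) (by simp) =
        X.hsq (X.runit m).hom (X.one cg.pro) (by simp) ≫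
          X.hsq (X.lunit m).inv (X.one cg.pro) (by simp) := by
      rw [hsq_hsq]; exact hsq_congr _ rfl (by simp)
    rw [this, ← X.triangle]
    simp only [Category.assoc]
    rw [Iso.inv_hom_id_assoc, ← Category.assoc, hsq_hsq,
      hsq_eq_one _ (Category.comp_id _) (Iso.inv_hom_id _), Category.id_comp]
  unfold slide
  rw [← Category.id_comp β, ← e₁]
  simp only [Category.assoc]
  rw [← runit_hcomp m cg.pro, Category.assoc, ← runit_naturality' β hβ,
    assoc_inv_naturality_assoc _ _ _ (by simp) (by simp), ← Category.assoc (X.hsq (X.hsq _ _ _) _ _),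
    e₂]
  simp only [Category.assoc]
  rw [← Category.assoc (X.assoc _ _ _).inv, ← Category.assoc (X.hsq (X.one m) _ _), e₃,
    Category.assoc, ← assoc_inv_naturality_assoc _ _ _ (by simp [hf]) (by simp [hg]), runit_hcomp]

lemma paste_coherence {x y : X.Obj} (m : X.Pro x y) :
    X.hsq (X.one m) (X.lunit (X.hid y)).inv (by simp) ≫
        OplaxProtrans.paste ((X.runit m).hom ≫ (X.lunit m).inv) ((X.runit m).hom ≫ (X.lunit m).inv)
          (by simp) (by simp) =
      ((X.runit m).hom ≫ (X.lunit m).inv) ≫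
        X.hsq (X.lunit (X.hid x)).inv (X.one m) (by simp) := by
  have := (by intro a b m; bicategory : ∀ {a b : Hor X} (m : a ⟶ b),
    Bicategory.whiskerLeft m (Bicategory.leftUnitor (𝟙 b)).inv ≫
      (Bicategory.associator m (𝟙 b) (𝟙 b)).inv ≫
      Bicategory.whiskerRight ((Bicategory.rightUnitor m).hom ≫ (Bicategory.leftUnitor m).inv)
        (𝟙 b) ≫ (Bicategory.associator (𝟙 a) m (𝟙 b)).hom ≫
      Bicategory.whiskerLeft (𝟙 a) ((Bicategory.rightUnitor m).hom ≫
        (Bicategory.leftUnitor m).inv) ≫ (Bicategory.associator (𝟙 a) (𝟙 a) m).inv =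
    ((Bicategory.rightUnitor m).hom ≫ (Bicategory.leftUnitor m).inv) ≫
      Bicategory.whiskerRight (Bicategory.leftUnitor (𝟙 a)).inv m)
  exact congrArg Glob.sq (this (a := ⟨x⟩) (b := ⟨y⟩) m)

lemma right_paste {x₀ x₁ x₂ y₀ y₁ y₂ : X.Obj} {a : X.Pro x₀ y₀} {b : X.Pro x₁ y₁}
    {c : X.Pro x₂ y₂} {p : X.Pro x₀ x₁} {q : X.Pro x₁ x₂} {p' : X.Pro y₀ y₁} {q' : X.Pro y₁ y₂}
    (s : X.Sq (X.hcomp a p') (X.hcomp p b)) (t : X.Sq (X.hcomp b q') (X.hcomp q c))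
    (hs : X.right s = 𝟙 _) (ht : X.left t = 𝟙 _) :
    X.right (OplaxProtrans.paste s t hs ht) = X.right t := by
  simp [OplaxProtrans.paste]

lemma slide_comp {x y x' y' x'' y'' : X.Obj} {m : X.Pro x y} {m' : X.Pro x' y'}
    {m'' : X.Pro x'' y''} {f : x ⟶ x'} {g : y ⟶ y'} {f' : x' ⟶ x''} {g' : y' ⟶ y''}
    (cf : Companion f) (cg : Companion g) (cf' : Companion f') (cg' : Companion g')
    (α : X.Sq m m') (α' : X.Sq m' m'') (hf : X.left α = f) (hg : X.right α = g)
    (hf' : X.left α' = f') (hg' : X.right α' = g') :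
    OplaxProtrans.paste (slide cf cg α hf hg) (slide cf' cg' α' hf' hg')
        (by simp [slide]) (by simp [slide]) =
      slide (cf.comp cf') (cg.comp cg') (α ≫ α') (by simp [hf, hf']) (by simp [hg, hg']) := by
  refine eq_slide (cf.comp cf') (cg.comp cg') _ _ _ _ ((right_paste _ _ _ _).trans (by simp [slide])) ?_
  have e₁ := unit_slide cf cg α hf hg
  have e₂ : X.hsq α (X.hidSq g ≫ cg'.unit) (by simp [hg]) ≫ slide cf' cg' α' hf' hg' =
      ((X.runit m).hom ≫ (X.lunit m).inv) ≫
        X.hsq (X.hidSq f ≫ cf'.unit) (α ≫ α') (by simp [hf, hf']) := by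
    have h : X.hsq α (X.hidSq g ≫ cg'.unit) (by simp [hg]) =
        X.hsq α (X.hidSq g) (by simp [hg]) ≫ X.hsq (X.one m') cg'.unit (by simp) := by
      rw [hsq_hsq]; exact hsq_congr _ (by simp) rfl
    rw [h, Category.assoc, unit_slide, ← Category.assoc,
      OplaxProtrans.idSq_naturality α hf hg, Category.assoc, hsq_hsq]
  have e₃ := OplaxProtrans.paste_naturality (hs := by simp) (ht := by simp)
    (hS := by simp [slide]) (hT := by simp [slide])
    (X.one m) α (α ≫ α') cf.unit (X.hidSq f ≫ cf'.unit)
    cg.unit (X.hidSq g ≫ cg'.unit) (by simp) (by simp [hf]) (by simp [hg]) (by simp [hf, hf'])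
    (by simp) (by simp) e₁ e₂
  have h : X.hsq (X.one m) (cg.comp cg').unit (by simp) =
      X.hsq (X.one m) (X.lunit (X.hid y)).inv (by simp) ≫
        X.hsq (X.one m) (X.hsq cg.unit (X.hidSq g ≫ cg'.unit) (by simp)) (by simp) := by
    rw [hsq_hsq]; exact hsq_congr _ (by simp) (Companion.comp_unit cg cg')
  have h' : X.hsq (cf.comp cf').unit (α ≫ α') (by simp [hf, hf']) =
      X.hsq (X.lunit (X.hid x)).inv (X.one m) (by simp) ≫
        X.hsq (X.hsq cf.unit (X.hidSq f ≫ cf'.unit) (by simp)) (α ≫ α') (by simp [hf, hf']) := by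
    rw [hsq_hsq]; exact hsq_congr _ (Companion.comp_unit cf cf') (by simp)
  refine Eq.trans (congrArg (· ≫ OplaxProtrans.paste (slide cf cg α hf hg)
    (slide cf' cg' α' hf' hg') (by simp [slide]) (by simp [slide])) h) ?_
  refine Eq.trans ?_ (congrArg (((X.runit m).hom ≫ (X.lunit m).inv) ≫ ·) h').symm
  refine (Category.assoc _ _ _).trans ?_
  refine (congrArg (_ ≫ ·) e₃).trans ?_
  rw [← Category.assoc, paste_coherence, Category.assoc]
  rfl

lemma isCommuter_of {x y x' y' : X.Obj} {m : X.Pro x y} {n : X.Pro x' y'} {f : x ⟶ x'}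
    {g : y ⟶ y'} (cf : Companion f) (cg : Companion g) (α : X.Sq m n) (hf : X.left α = f)
    (hg : X.right α = g) (h : IsIso (slide cf cg α hf hg)) : IsCommuter α := by
  subst hf hg; exact ⟨cf, cg, h⟩

lemma isCommuter_id {x y : X.Obj} (m : X.Pro x y) : IsCommuter (X.one m) :=
  isCommuter_of _ _ _ _ _ (slide_id m)

lemma IsCommuter.comp {x y x' y' x'' y'' : X.Obj} {m : X.Pro x y} {m' : X.Pro x' y'}
    {m'' : X.Pro x'' y''} {α : X.Sq m m'} {α' : X.Sq m' m''} (h : IsCommuter α)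
    (h' : IsCommuter α') : IsCommuter (α ≫ α') := by
  obtain ⟨cf, cg, hi⟩ := h
  obtain ⟨cf', cg', hi'⟩ := h'
  refine isCommuter_of (cf.comp cf') (cg.comp cg') _ (by simp) (by simp) ?_
  rw [← slide_comp cf cg cf' cg' α α' rfl rfl rfl rfl]
  exact OplaxProtrans.isIso_paste _ _ _ _

end companions

/-- A strict double category. A cell in `Sq x y x' y'` has the given corners; its boundary consists
of the proarrows `top`, `bot` and of the arrows `left`, `right`. -/
structure StrictDoubleCategory where
  Obj : Type u
  Arr : Obj → Obj → Type v
  arrId (x : Obj) : Arr x x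
  arrComp {x y z : Obj} : Arr x y → Arr y z → Arr x z
  arr_id_comp {x y : Obj} (f : Arr x y) : arrComp (arrId x) f = f
  arr_comp_id {x y : Obj} (f : Arr x y) : arrComp f (arrId y) = f
  arr_assoc {x y z a : Obj} (f : Arr x y) (g : Arr y z) (h : Arr z a) :
    arrComp (arrComp f g) h = arrComp f (arrComp g h)
  Pro : Obj → Obj → Type w
  proId (x : Obj) : Pro x x
  proComp {x y z : Obj} : Pro x y → Pro y z → Pro x z
  pro_id_comp {x y : Obj} (m : Pro x y) : proComp (proId x) m = m
  pro_comp_id {x y : Obj} (m : Pro x y) : proComp m (proId y) = m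
  pro_assoc {x y z a : Obj} (m : Pro x y) (n : Pro y z) (p : Pro z a) :
    proComp (proComp m n) p = proComp m (proComp n p)
  Sq (x y x' y' : Obj) : Type t
  top {x y x' y' : Obj} : Sq x y x' y' → Pro x y
  bot {x y x' y' : Obj} : Sq x y x' y' → Pro x' y'
  left {x y x' y' : Obj} : Sq x y x' y' → Arr x x'
  right {x y x' y' : Obj} : Sq x y x' y' → Arr y y'
  /-- internal identity cells -/
  vid {x y : Obj} (m : Pro x y) : Sq x y x y
  top_vid {x y : Obj} (m : Pro x y) : top (vid m) = m
  bot_vid {x y : Obj} (m : Pro x y) : bot (vid m) = m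
  left_vid {x y : Obj} (m : Pro x y) : left (vid m) = arrId x
  right_vid {x y : Obj} (m : Pro x y) : right (vid m) = arrId y
  /-- internal composition of cells -/
  vcomp {x y x' y' x'' y'' : Obj} (α : Sq x y x' y') (β : Sq x' y' x'' y'') (h : bot α = top β) :
    Sq x y x'' y''
  top_vcomp {x y x' y' x'' y'' : Obj} (α : Sq x y x' y') (β : Sq x' y' x'' y'')
    (h : bot α = top β) : top (vcomp α β h) = top α
  bot_vcomp {x y x' y' x'' y'' : Obj} (α : Sq x y x' y') (β : Sq x' y' x'' y'')
    (h : bot α = top β) : bot (vcomp α β h) = bot β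
  left_vcomp {x y x' y' x'' y'' : Obj} (α : Sq x y x' y') (β : Sq x' y' x'' y'')
    (h : bot α = top β) : left (vcomp α β h) = arrComp (left α) (left β)
  right_vcomp {x y x' y' x'' y'' : Obj} (α : Sq x y x' y') (β : Sq x' y' x'' y'')
    (h : bot α = top β) : right (vcomp α β h) = arrComp (right α) (right β)
  /-- external identity cells -/
  hid {x y : Obj} (f : Arr x y) : Sq x x y y
  left_hid {x y : Obj} (f : Arr x y) : left (hid f) = f
  right_hid {x y : Obj} (f : Arr x y) : right (hid f) = f
  top_hid {x y : Obj} (f : Arr x y) : top (hid f) = proId x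
  bot_hid {x y : Obj} (f : Arr x y) : bot (hid f) = proId y
  /-- external composition of cells -/
  hcomp {x y z x' y' z' : Obj} (α : Sq x y x' y') (β : Sq y z y' z') (h : right α = left β) :
    Sq x z x' z'
  left_hcomp {x y z x' y' z' : Obj} (α : Sq x y x' y') (β : Sq y z y' z')
    (h : right α = left β) : left (hcomp α β h) = left α
  right_hcomp {x y z x' y' z' : Obj} (α : Sq x y x' y') (β : Sq y z y' z')
    (h : right α = left β) : right (hcomp α β h) = right β
  top_hcomp {x y z x' y' z' : Obj} (α : Sq x y x' y') (β : Sq y z y' z')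
    (h : right α = left β) : top (hcomp α β h) = proComp (top α) (top β)
  bot_hcomp {x y z x' y' z' : Obj} (α : Sq x y x' y') (β : Sq y z y' z')
    (h : right α = left β) : bot (hcomp α β h) = proComp (bot α) (bot β)
  vid_vcomp {x y x' y' : Obj} (α : Sq x y x' y') : vcomp (vid (top α)) α (bot_vid _) = α
  vcomp_vid {x y x' y' : Obj} (α : Sq x y x' y') : vcomp α (vid (bot α)) (top_vid _).symm = α
  vcomp_assoc {x y x' y' x'' y'' x₃ y₃ : Obj} (α : Sq x y x' y') (β : Sq x' y' x'' y'')
    (γ : Sq x'' y'' x₃ y₃) (h : bot α = top β) (k : bot β = top γ) :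
    vcomp (vcomp α β h) γ ((bot_vcomp _ _ _).trans k) =
      vcomp α (vcomp β γ k) (h.trans (top_vcomp _ _ _).symm)
  hid_hcomp {x y x' y' : Obj} (α : Sq x y x' y') : hcomp (hid (left α)) α (right_hid _) = α
  hcomp_hid {x y x' y' : Obj} (α : Sq x y x' y') : hcomp α (hid (right α)) (left_hid _).symm = α
  hcomp_assoc {x y z a x' y' z' a' : Obj} (α : Sq x y x' y') (β : Sq y z y' z')
    (γ : Sq z a z' a') (h : right α = left β) (k : right β = left γ) :
    hcomp (hcomp α β h) γ ((right_hcomp _ _ _).trans k) =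
      hcomp α (hcomp β γ k) (h.trans (left_hcomp _ _ _).symm)
  vid_proId (x : Obj) : vid (proId x) = hid (arrId x)
  vid_proComp {x y z : Obj} (m : Pro x y) (n : Pro y z) :
    vid (proComp m n) = hcomp (vid m) (vid n) ((right_vid m).trans (left_vid n).symm)
  hid_arrComp {x y z : Obj} (f : Arr x y) (g : Arr y z) :
    hid (arrComp f g) = vcomp (hid f) (hid g) ((bot_hid f).trans (top_hid g).symm)
  interchange {x y z x' y' z' x'' y'' z'' : Obj} (α : Sq x y x' y') (β : Sq y z y' z')
    (γ : Sq x' y' x'' y'') (δ : Sq y' z' y'' z'') (h : right α = left β) (h' : right γ = left δ)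
    (k : bot α = top γ) (k' : bot β = top δ) :
    vcomp (hcomp α β h) (hcomp γ δ h')
        ((bot_hcomp _ _ _).trans ((congrArg₂ proComp k k').trans (top_hcomp _ _ _).symm)) =
      hcomp (vcomp α γ k) (vcomp β δ k')
        ((right_vcomp _ _ _).trans ((congrArg₂ arrComp h h').trans (left_vcomp _ _ _).symm))

namespace StrictDoubleCategory

/-- The transpose: arrows and proarrows are interchanged. -/
def transpose (X : StrictDoubleCategory.{u, v, w, t}) : StrictDoubleCategory.{u, w, v, t} where
  Obj := X.Obj
  Arr := X.Pro
  arrId := X.proId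
  arrComp := X.proComp
  arr_id_comp := X.pro_id_comp
  arr_comp_id := X.pro_comp_id
  arr_assoc := X.pro_assoc
  Pro := X.Arr
  proId := X.arrId
  proComp := X.arrComp
  pro_id_comp := X.arr_id_comp
  pro_comp_id := X.arr_comp_id
  pro_assoc := X.arr_assoc
  Sq x y x' y' := X.Sq x x' y y'
  top := X.left
  bot := X.right
  left := X.top
  right := X.bot
  vid := X.hid
  top_vid := X.left_hid
  bot_vid := X.right_hid
  left_vid := X.top_hid
  right_vid := X.bot_hid
  vcomp := X.hcomp
  top_vcomp := X.left_hcomp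
  bot_vcomp := X.right_hcomp
  left_vcomp := X.top_hcomp
  right_vcomp := X.bot_hcomp
  hid := X.vid
  left_hid := X.top_vid
  right_hid := X.bot_vid
  top_hid := X.left_vid
  bot_hid := X.right_vid
  hcomp := X.vcomp
  left_hcomp := X.top_vcomp
  right_hcomp := X.bot_vcomp
  top_hcomp := X.left_vcomp
  bot_hcomp := X.right_vcomp
  vid_vcomp := X.hid_hcomp
  vcomp_vid := X.hcomp_hid
  vcomp_assoc := X.hcomp_assoc
  hid_hcomp := X.vid_vcomp
  hcomp_hid := X.vcomp_vid
  hcomp_assoc := X.vcomp_assoc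
  vid_proId x := (X.vid_proId x).symm
  vid_proComp := X.hid_arrComp
  hid_arrComp := X.vid_proComp
  interchange α β γ δ h h' k k' := (X.interchange α γ β δ k k' h h').symm

section

variable {X : StrictDoubleCategory.{u, v, w, t}}

lemma vcomp_congr {x y x' y' x'' y'' : X.Obj} {α α' : X.Sq x y x' y'} {β β' : X.Sq x' y' x'' y''}
    (h : X.bot α = X.top β) (e : α = α') (e' : β = β') :
    X.vcomp α β h = X.vcomp α' β' (by rw [← e, ← e', h]) := by
  subst e e'; rfl

lemma hcomp_congr {x y z x' y' z' : X.Obj} {α α' : X.Sq x y x' y'} {β β' : X.Sq y z y' z'}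
    (h : X.right α = X.left β) (e : α = α') (e' : β = β') :
    X.hcomp α β h = X.hcomp α' β' (by rw [← e, ← e', h]) := by
  subst e e'; rfl

lemma vid_vcomp' {x y x' y' : X.Obj} {m : X.Pro x y} (α : X.Sq x y x' y')
    (h : X.bot (X.vid m) = X.top α) : X.vcomp (X.vid m) α h = α := by
  obtain rfl : m = X.top α := (X.bot_vid m).symm.trans h
  exact X.vid_vcomp α

lemma vcomp_vid' {x y x' y' : X.Obj} {m : X.Pro x' y'} (α : X.Sq x y x' y')
    (h : X.bot α = X.top (X.vid m)) : X.vcomp α (X.vid m) h = α := by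
  obtain rfl : X.bot α = m := h.trans (X.top_vid m)
  exact X.vcomp_vid α

lemma hid_hcomp' {x y x' y' : X.Obj} {f : X.Arr x x'} (α : X.Sq x y x' y')
    (h : X.right (X.hid f) = X.left α) : X.hcomp (X.hid f) α h = α := by
  obtain rfl : f = X.left α := (X.right_hid f).symm.trans h
  exact X.hid_hcomp α

lemma hcomp_hid' {x y x' y' : X.Obj} {f : X.Arr y y'} (α : X.Sq x y x' y')
    (h : X.right α = X.left (X.hid f)) : X.hcomp α (X.hid f) h = α := by
  obtain rfl : X.right α = f := h.trans (X.left_hid f)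
  exact X.hcomp_hid α

/-- The category of proarrows and cells. -/
abbrev sqCategory (X : StrictDoubleCategory.{u, v, w, t}) : Category.{t} (ProObj X.Pro) where
  Hom m n := {α : X.Sq m.src m.tgt n.src n.tgt // X.top α = m.pro ∧ X.bot α = n.pro}
  id m := ⟨X.vid m.pro, X.top_vid _, X.bot_vid _⟩
  comp α β := ⟨X.vcomp α.1 β.1 (α.2.2.trans β.2.1.symm),
    (X.top_vcomp _ _ _).trans α.2.1, (X.bot_vcomp _ _ _).trans β.2.2⟩
  id_comp α := Subtype.ext (vid_vcomp' _ _)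
  comp_id α := Subtype.ext (vcomp_vid' _ _)
  assoc α β γ := Subtype.ext (X.vcomp_assoc _ _ _ _ _)

/-- The category of objects and arrows. -/
abbrev arrCategory (X : StrictDoubleCategory.{u, v, w, t}) : Category.{v} X.Obj where
  Hom := X.Arr
  id := X.arrId
  comp := X.arrComp
  id_comp := X.arr_id_comp
  comp_id := X.arr_comp_id
  assoc := X.arr_assoc

/-- The identity cell between equal proarrows. -/
abbrev isoOfEq (X : StrictDoubleCategory.{u, v, w, t}) {x y : X.Obj} {m n : X.Pro x y}
    (h : m = n) :
    letI := X.sqCategory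
    ProObj.mk m ≅ ProObj.mk n :=
  letI := X.sqCategory
  { hom := ⟨X.vid m, X.top_vid _, (X.bot_vid _).trans h⟩
    inv := ⟨X.vid m, (X.top_vid _).trans h, X.bot_vid _⟩
    hom_inv_id := Subtype.ext (vid_vcomp' _ _)
    inv_hom_id := Subtype.ext ((vid_vcomp' _ _).trans (congrArg X.vid h)) }

/-- A strict double category, regarded as a double category with trivial coherence cells. -/
def toDouble (X : StrictDoubleCategory.{u, v, w, t}) : DoubleCategory.{u, v, w, t} where
  Obj := X.Obj
  cat := X.arrCategory
  Pro := X.Pro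
  sqCat := X.sqCategory
  left α := X.left α.1
  right α := X.right α.1
  left_one _ := X.left_vid _
  right_one _ := X.right_vid _
  left_comp _ _ := X.left_vcomp _ _ _
  right_comp _ _ := X.right_vcomp _ _ _
  hid := X.proId
  hidSq f := ⟨X.hid f, X.top_hid f, X.bot_hid f⟩
  left_hidSq := X.left_hid
  right_hidSq := X.right_hid
  hidSq_id x := Subtype.ext (X.vid_proId x).symm
  hidSq_comp f g := Subtype.ext (X.hid_arrComp f g)
  hcomp := X.proComp
  hsq α β h := ⟨X.hcomp α.1 β.1 h,
    (X.top_hcomp _ _ _).trans (congrArg₂ X.proComp α.2.1 β.2.1),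
    (X.bot_hcomp _ _ _).trans (congrArg₂ X.proComp α.2.2 β.2.2)⟩
  left_hsq _ _ _ := X.left_hcomp _ _ _
  right_hsq _ _ _ := X.right_hcomp _ _ _
  hsq_one m n := Subtype.ext (X.vid_proComp m n).symm
  hsq_comp α β h α' β' h' := Subtype.ext (X.interchange _ _ _ _ _ _ _ _).symm
  assoc m n p := X.isoOfEq (X.pro_assoc m n p)
  left_assoc _ _ _ := X.left_vid _
  right_assoc _ _ _ := X.right_vid _
  assoc_naturality _ _ _ _ _ := Subtype.ext
    ((vcomp_vid' _ _).trans ((X.hcomp_assoc _ _ _ _ _).trans (vid_vcomp' _ _).symm))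
  lunit m := X.isoOfEq (X.pro_id_comp m)
  left_lunit _ := X.left_vid _
  right_lunit _ := X.right_vid _
  lunit_naturality _ := Subtype.ext
    ((vcomp_vid' _ _).trans ((X.hid_hcomp _).trans (vid_vcomp' _ _).symm))
  runit m := X.isoOfEq (X.pro_comp_id m)
  left_runit _ := X.left_vid _
  right_runit _ := X.right_vid _
  runit_naturality _ := Subtype.ext
    ((vcomp_vid' _ _).trans ((X.hcomp_hid _).trans (vid_vcomp' _ _).symm))
  pentagon m n p q := Subtype.ext (by
    refine (vcomp_congr _ (X.vid_proComp _ _).symm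
      (vcomp_congr _ rfl (X.vid_proComp _ _).symm)).trans ?_
    refine (vid_vcomp' _ _).trans ((vid_vcomp' _ _).trans ?_)
    refine Eq.trans ?_ (vid_vcomp' _ _).symm
    exact congrArg X.vid (by simp only [X.pro_assoc]))
  triangle m n := Subtype.ext (by
    refine (vid_vcomp' _ _).trans ?_
    refine (X.vid_proComp _ _).symm.trans (Eq.trans ?_ (X.vid_proComp _ _))
    exact congrArg X.vid (by simp only [X.pro_id_comp, X.pro_comp_id]))

end

end StrictDoubleCategory

section quintets

variable {X : DoubleCategory.{u, v, w, t}}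

/-- Cells of the form `f ⇛ g`, for arrows `f`, `g`, compose externally. -/
def spComp {x y : X.Obj} (α β : X.Sq (X.hid x) (X.hid y)) (h : X.right α = X.left β) :
    X.Sq (X.hid x) (X.hid y) :=
  (X.lunit _).inv ≫ X.hsq α β h ≫ (X.lunit _).hom

@[simp] lemma left_spComp {x y : X.Obj} (α β : X.Sq (X.hid x) (X.hid y))
    (h : X.right α = X.left β) : X.left (spComp α β h) = X.left α := by
  simp [spComp]

@[simp] lemma right_spComp {x y : X.Obj} (α β : X.Sq (X.hid x) (X.hid y))
    (h : X.right α = X.left β) : X.right (spComp α β h) = X.right β := by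
  simp [spComp]

lemma spComp_congr {x y : X.Obj} {α β α' β' : X.Sq (X.hid x) (X.hid y)}
    (h : X.right α = X.left β) (e : α = α') (e' : β = β') :
    spComp α β h = spComp α' β' (by rw [← e, ← e', h]) := by
  subst e e'; rfl

lemma hid_spComp {x y : X.Obj} (α : X.Sq (X.hid x) (X.hid y)) {f : x ⟶ y} (hf : X.left α = f) :
    spComp (X.hidSq f) α (by simp [hf]) = α := by
  unfold spComp
  rw [lunit_naturality' α hf, Iso.inv_hom_id_assoc]

lemma spComp_hid {x y : X.Obj} (α : X.Sq (X.hid x) (X.hid y)) {f : x ⟶ y} (hf : X.right α = f) :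
    spComp α (X.hidSq f) (by simp [hf]) = α := by
  unfold spComp
  rw [unitors_hid, unitors_inv_hid, runit_naturality' α hf, Iso.inv_hom_id_assoc]

lemma spComp_comp {x y z : X.Obj} (α β : X.Sq (X.hid x) (X.hid y)) (h : X.right α = X.left β)
    (γ δ : X.Sq (X.hid y) (X.hid z)) (h' : X.right γ = X.left δ) :
    spComp α β h ≫ spComp γ δ h' = spComp (α ≫ γ) (β ≫ δ) (by simp [h, h']) := by
  unfold spComp
  simp only [Category.assoc, Iso.hom_inv_id_assoc]
  rw [hsq_hsq_assoc]

lemma spComp_whisker {x y z : X.Obj} (α β : X.Sq (X.hid x) (X.hid y)) (h : X.right α = X.left β)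
    (f : y ⟶ z) :
    spComp α β h ≫ X.hidSq f = spComp (α ≫ X.hidSq f) (β ≫ X.hidSq f) (by simp [h]) := by
  rw [← spComp_comp α β h _ _ (by simp), hid_spComp _ (by simp)]

lemma whisker_spComp {x y z : X.Obj} (f : x ⟶ y) (α β : X.Sq (X.hid y) (X.hid z))
    (h : X.right α = X.left β) :
    X.hidSq f ≫ spComp α β h = spComp (X.hidSq f ≫ α) (X.hidSq f ≫ β) (by simp [h]) := by
  rw [← spComp_comp _ _ (by simp) α β h, hid_spComp _ (by simp)]

lemma spComp_assoc {x y : X.Obj} (α β γ : X.Sq (X.hid x) (X.hid y)) (h : X.right α = X.left β)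
    (h' : X.right β = X.left γ) :
    spComp (spComp α β h) γ (by simp [h']) = spComp α (spComp β γ h') (by simp [h]) := by
  have e₁ : X.hsq ((X.lunit _).inv ≫ X.hsq α β h ≫ (X.lunit _).hom) γ (by simp [h']) =
      X.hsq (X.lunit _).inv (X.one _) (by simp) ≫ X.hsq (X.hsq α β h) γ (by simp [h']) ≫
        X.hsq (X.lunit _).hom (X.one _) (by simp) := by
    rw [hsq_hsq, hsq_hsq]; exact hsq_congr _ rfl (by simp)
  have e₂ : X.hsq α ((X.lunit _).inv ≫ X.hsq β γ h' ≫ (X.lunit _).hom) (by simp [h]) =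
      X.hsq (X.one _) (X.lunit _).inv (by simp) ≫ X.hsq α (X.hsq β γ h') (by simp [h]) ≫
        X.hsq (X.one _) (X.lunit _).hom (by simp) := by
    rw [hsq_hsq, hsq_hsq]; exact hsq_congr _ (by simp) rfl
  have e₃ (z : X.Obj) : X.hsq (X.lunit (X.hid z)).hom (X.one (X.hid z)) (by simp) =
      (X.assoc _ _ _).hom ≫ X.hsq (X.one (X.hid z)) (X.lunit (X.hid z)).hom (by simp) := by
    rw [X.triangle]; exact hsq_congr _ (unitors_hid z) rfl
  have e₄ (z : X.Obj) : X.hsq (X.lunit (X.hid z)).inv (X.one (X.hid z)) (by simp) =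
      X.hsq (X.one (X.hid z)) (X.lunit (X.hid z)).inv (by simp) ≫ (X.assoc _ _ _).inv := by
    have hi := isIso_hsq (X.lunit (X.hid z)).hom (X.one (X.hid z)) (by simp)
    rw [← cancel_mono (X.hsq (X.lunit (X.hid z)).hom (X.one (X.hid z)) (by simp)), hsq_hsq, e₃,
      Category.assoc, Iso.inv_hom_id_assoc, hsq_hsq]
    exact (hsq_eq_one _ (by simp) (by simp)).trans (hsq_eq_one _ (by simp) (by simp)).symm
  unfold spComp
  rw [e₁, e₂, e₃, e₄]
  simp only [Category.assoc]
  rw [X.assoc_naturality_assoc α β γ h h', Iso.inv_hom_id_assoc]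

variable (X) in
/-- A quintet: a square of arrows with top `γ`, bottom `δ` and with left and right sides `α`, `β` in
the class `W`, together with a cell `γ ≫ β ⇛ α ≫ δ` between external identities. -/
@[ext]
structure Quintet (W : ∀ ⦃x y : X.Obj⦄, (x ⟶ y) → Prop) (x y x' y' : X.Obj) where
  top : x ⟶ y
  bot : x' ⟶ y'
  left : {f : x ⟶ x' // W f}
  right : {f : y ⟶ y' // W f}
  sq : X.Sq (X.hid x) (X.hid y')
  left_sq : X.left sq = top ≫ right.1
  right_sq : X.right sq = left.1 ≫ bot

attribute [simp] Quintet.left_sq Quintet.right_sq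

variable (X) in
/-- The strict double category of quintets with the same objects as `X`, whose arrows are the arrows
of `X` in the class `W`, and whose proarrows are all arrows of `X`. -/
def quintets (W : ∀ ⦃x y : X.Obj⦄, (x ⟶ y) → Prop) (hW : ∀ x, W (𝟙 x))
    (hW' : ∀ ⦃x y z : X.Obj⦄ (f : x ⟶ y) (g : y ⟶ z), W f → W g → W (f ≫ g)) :
    StrictDoubleCategory.{u, v, v, max v t} where
  Obj := X.Obj
  Arr x y := {f : x ⟶ y // W f}
  arrId x := ⟨𝟙 x, hW x⟩
  arrComp f g := ⟨f.1 ≫ g.1, hW' f.1 g.1 f.2 g.2⟩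
  arr_id_comp f := Subtype.ext (Category.id_comp f.1)
  arr_comp_id f := Subtype.ext (Category.comp_id f.1)
  arr_assoc f g h := Subtype.ext (Category.assoc f.1 g.1 h.1)
  Pro x y := x ⟶ y
  proId x := 𝟙 x
  proComp f g := f ≫ g
  pro_id_comp f := Category.id_comp f
  pro_comp_id f := Category.comp_id f
  pro_assoc f g h := Category.assoc f g h
  Sq x y x' y' := Quintet X W x y x' y'
  top α := α.top
  bot α := α.bot
  left α := α.left
  right α := α.right
  vid m := ⟨m, m, ⟨𝟙 _, hW _⟩, ⟨𝟙 _, hW _⟩, X.hidSq m, by simp, by simp⟩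
  top_vid _ := rfl
  bot_vid _ := rfl
  left_vid _ := rfl
  right_vid _ := rfl
  vcomp α β h :=
    { top := α.top
      bot := β.bot
      left := ⟨α.left.1 ≫ β.left.1, hW' _ _ α.left.2 β.left.2⟩
      right := ⟨α.right.1 ≫ β.right.1, hW' _ _ α.right.2 β.right.2⟩
      sq := spComp (α.sq ≫ X.hidSq β.right.1) (X.hidSq α.left.1 ≫ β.sq) (by simp [h])
      left_sq := by simp
      right_sq := by simp }
  top_vcomp _ _ _ := rfl
  bot_vcomp _ _ _ := rfl
  left_vcomp _ _ _ := rfl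
  right_vcomp _ _ _ := rfl
  hid f := ⟨𝟙 _, 𝟙 _, f, f, X.hidSq f.1, by simp, by simp⟩
  left_hid _ := rfl
  right_hid _ := rfl
  top_hid _ := rfl
  bot_hid _ := rfl
  hcomp α β h :=
    { top := α.top ≫ β.top
      bot := α.bot ≫ β.bot
      left := α.left
      right := β.right
      sq := spComp (X.hidSq α.top ≫ β.sq) (α.sq ≫ X.hidSq β.bot) (by simp [h])
      left_sq := by simp
      right_sq := by simp }
  left_hcomp _ _ _ := rfl
  right_hcomp _ _ _ := rfl
  top_hcomp _ _ _ := rfl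
  bot_hcomp _ _ _ := rfl
  vid_vcomp α := by
    ext1 <;> try rfl
    · exact Subtype.ext (Category.id_comp _)
    · exact Subtype.ext (Category.id_comp _)
    · refine Eq.trans (spComp_congr _ (X.hidSq_comp _ _).symm
        ((congrArg (· ≫ α.sq) (X.hidSq_id _)).trans (Category.id_comp _))) ?_
      exact hid_spComp _ α.left_sq
  vcomp_vid α := by
    ext1 <;> try rfl
    · exact Subtype.ext (Category.comp_id _)
    · exact Subtype.ext (Category.comp_id _)
    · refine Eq.trans (spComp_congr _
        ((congrArg (α.sq ≫ ·) (X.hidSq_id _)).trans (Category.comp_id _))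
        (X.hidSq_comp _ _).symm) ?_
      exact spComp_hid _ α.right_sq
  vcomp_assoc α β γ h k := by
    ext1 <;> try rfl
    · exact Subtype.ext (Category.assoc _ _ _)
    · exact Subtype.ext (Category.assoc _ _ _)
    · refine (spComp_congr _ (spComp_whisker _ _ _ _) rfl).trans ?_
      refine Eq.trans ?_ (spComp_congr _ rfl (whisker_spComp _ _ _ _)).symm
      refine Eq.trans (spComp_congr _ (spComp_congr _ ?_ ?_) ?_) (spComp_assoc _ _ _ ?_ ?_)
      all_goals simp [hidSq_comp, h, k]
  hid_hcomp α := by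
    ext1 <;> try rfl
    · exact Category.id_comp _
    · exact Category.id_comp _
    · refine Eq.trans (spComp_congr _
        ((congrArg (· ≫ α.sq) (X.hidSq_id _)).trans (Category.id_comp _))
        (X.hidSq_comp _ _).symm) ?_
      exact spComp_hid _ α.right_sq
  hcomp_hid α := by
    ext1 <;> try rfl
    · exact Category.comp_id _
    · exact Category.comp_id _
    · refine Eq.trans (spComp_congr _ (X.hidSq_comp _ _).symm
        ((congrArg (α.sq ≫ ·) (X.hidSq_id _)).trans (Category.comp_id _))) ?_
      exact hid_spComp _ α.left_sq
  hcomp_assoc α β γ h k := by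
    ext1 <;> try rfl
    · exact Category.assoc _ _ _
    · exact Category.assoc _ _ _
    · refine (spComp_congr _ rfl (spComp_whisker _ _ _ _)).trans ?_
      refine Eq.trans ?_ (spComp_congr _ (whisker_spComp _ _ _ _) rfl).symm
      refine Eq.trans (spComp_congr _ ?_ (spComp_congr _ ?_ ?_)) (spComp_assoc _ _ _ ?_ ?_).symm
      all_goals simp [hidSq_comp, h, k]
  vid_proId x := by
    ext1 <;> rfl
  vid_proComp f g := by
    ext1 <;> try rfl
    exact ((spComp_congr _ (X.hidSq_comp _ _).symm (X.hidSq_comp _ _).symm).trans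
      (hid_spComp _ (by simp))).symm
  hid_arrComp f g := by
    ext1 <;> try rfl
    exact ((spComp_congr _ (X.hidSq_comp _ _).symm (X.hidSq_comp _ _).symm).trans
      (hid_spComp _ (by simp))).symm
  interchange α β γ δ h h' k k' := by
    have a₁ : X.hidSq α.right.1 = X.hidSq β.left.1 := by rw [h]
    have a₂ : X.hidSq γ.right.1 = X.hidSq δ.left.1 := by rw [h']
    have a₃ : X.hidSq α.bot = X.hidSq γ.top := by rw [k]
    have a₄ : X.hidSq β.bot = X.hidSq δ.top := by rw [k']
    have m₁ : spComp (α.sq ≫ X.hidSq β.bot ≫ X.hidSq δ.right.1)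
        (X.hidSq α.left.1 ≫ X.hidSq γ.top ≫ δ.sq) (by simp [k, k']) = α.sq ≫ δ.sq := by
      have e := spComp_comp α.sq (X.hidSq (α.left.1 ≫ α.bot)) (by simp)
        (X.hidSq (δ.top ≫ δ.right.1)) δ.sq (by simp)
      rw [spComp_hid _ α.right_sq, hid_spComp _ δ.left_sq] at e
      rw [e]
      refine spComp_congr _ ?_ ?_
      · rw [a₄, hidSq_comp]
      · rw [← a₃, hidSq_comp, Category.assoc]
    have m₂ : spComp (X.hidSq α.top ≫ X.hidSq β.left.1 ≫ δ.sq)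
        (α.sq ≫ X.hidSq γ.right.1 ≫ X.hidSq δ.bot) (by simp [h, h']) = α.sq ≫ δ.sq := by
      have e := spComp_comp (X.hidSq (α.top ≫ α.right.1)) α.sq (by simp)
        δ.sq (X.hidSq (δ.left.1 ≫ δ.bot)) (by simp)
      rw [hid_spComp _ α.left_sq, spComp_hid _ δ.right_sq] at e
      rw [e]
      refine spComp_congr _ ?_ ?_
      · rw [← a₁, hidSq_comp, Category.assoc]
      · rw [a₂, hidSq_comp]
    have aux : ∀ {x y : X.Obj} (p q r s q' r' : X.Sq (X.hid x) (X.hid y))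
        (h₁ : X.right p = X.left q) (h₂ : X.right q = X.left r) (h₃ : X.right r = X.left s)
        (h₁' : X.right p = X.left q') (h₂' : X.right q' = X.left r')
        (h₃' : X.right r' = X.left s) (e : spComp q r h₂ = spComp q' r' h₂'),
        spComp (spComp p q h₁) (spComp r s h₃) (by simp [h₂]) =
          spComp (spComp p q' h₁') (spComp r' s h₃') (by simp [h₂']) := by
      intro x y p q r s q' r' h₁ h₂ h₃ h₁' h₂' h₃' e
      rw [spComp_assoc p q _ h₁ (by simp [h₂]), spComp_assoc p q' _ h₁' (by simp [h₂'])]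
      refine spComp_congr _ rfl ?_
      rw [← spComp_assoc q r s h₂ h₃, ← spComp_assoc q' r' s h₂' h₃']
      exact spComp_congr _ e rfl
    ext1 <;> try rfl
    refine (spComp_congr _ (spComp_whisker _ _ _ _) (whisker_spComp _ _ _ _)).trans ?_
    refine Eq.trans ?_ (spComp_congr _ (whisker_spComp _ _ _ _) (spComp_whisker _ _ _ _)).symm
    simp only [Category.assoc]
    exact aux _ _ _ _ _ _ _ _ _ _ _ _ (m₁.trans m₂.symm)

end quintets

/-- Natural transformations whose component arrows have companions. -/
def HasCompanionComponents {F G : LaxDoubleFunctor D E} (α : F ⟶ G) : Prop :=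
  ∀ x : D.Obj, Nonempty (Companion (LaxDoubleFunctor.NatTrans.app α x))

/-- Natural transformations whose component cells are commuters. -/
def HasCommuterComponents {F G : LaxDoubleFunctor D E} (α : F ⟶ G) : Prop :=
  ∀ ⦃x y : D.Obj⦄ (m : D.Pro x y), IsCommuter (LaxDoubleFunctor.NatTrans.sq α m)

lemma hasCompanionComponents_id (F : LaxDoubleFunctor D E) : HasCompanionComponents (𝟙 F) :=
  fun _ => ⟨Companion.id _⟩

lemma HasCompanionComponents.comp {F G H : LaxDoubleFunctor D E} {α : F ⟶ G} {β : G ⟶ H}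
    (h : HasCompanionComponents α) (h' : HasCompanionComponents β) :
    HasCompanionComponents (α ≫ β) :=
  fun x => ⟨(h x).some.comp (h' x).some⟩

lemma hasCommuterComponents_id (F : LaxDoubleFunctor D E) : HasCommuterComponents (𝟙 F) :=
  fun _ _ m => isCommuter_id (F.pro m)

lemma HasCommuterComponents.comp {F G H : LaxDoubleFunctor D E} {α : F ⟶ G} {β : G ⟶ H}
    (h : HasCommuterComponents α) (h' : HasCommuterComponents β) :
    HasCommuterComponents (α ≫ β) :=
  fun _ _ m => (h m).comp (h' m)

/-- The strict double category of lax double functors; its arrows are natural transformations whose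
component arrows have companions, its proarrows are natural transformations, and its cells are
modifications (bounded by identity protransformations) from the composite of the top and right sides
to the composite of the left and bottom sides. -/
def LaxComp (D : DoubleCategory.{u₁, v₁, w₁, t₁}) (E : DoubleCategory.{u₂, v₂, w₂, t₂}) :
    StrictDoubleCategory :=
  quintets (LaxOpl D E)
    (fun (F G : LaxDoubleFunctor D E) (α : F ⟶ G) => HasCompanionComponents α)
    hasCompanionComponents_id
    (fun (_ _ _ : LaxDoubleFunctor D E) _ _ h h' => h.comp h')

/-- The variant of `LaxComp D E` whose arrows are natural transformations whose component arrows have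
companions and whose component cells are commuters. -/
def LaxCC (D : DoubleCategory.{u₁, v₁, w₁, t₁}) (E : DoubleCategory.{u₂, v₂, w₂, t₂}) :
    StrictDoubleCategory :=
  quintets (LaxOpl D E)
    (fun (F G : LaxDoubleFunctor D E) (α : F ⟶ G) =>
      HasCompanionComponents α ∧ HasCommuterComponents α)
    (fun F => ⟨hasCompanionComponents_id F, hasCommuterComponents_id F⟩)
    (fun (_ _ _ : LaxDoubleFunctor D E) _ _ h h' => ⟨h.1.comp h'.1, h.2.comp h'.2⟩)

/-- The functor that is the identity on lax double functors and natural transformations. -/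
def LaxComp.idFunctor (D : DoubleCategory.{u₁, v₁, w₁, t₁}) (E : DoubleCategory.{u₂, v₂, w₂, t₂}) :
    (LaxComp D E).transpose.toDouble.Obj ⥤ (LaxOpl D E).Obj where
  obj F := F
  map α := α
  map_id _ := rfl
  map_comp _ _ := rfl

/-- The functor that is the identity on lax double functors and natural transformations. -/
def LaxCC.idFunctor (D : DoubleCategory.{u₁, v₁, w₁, t₁}) (E : DoubleCategory.{u₂, v₂, w₂, t₂}) :
    (LaxCC D E).transpose.toDouble.Obj ⥤ (LaxPs D E).Obj where
  obj F := F
  map α := α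
  map_id _ := rfl
  map_comp _ _ := rfl

end DoubleCategory

/-! Two facts combine.

The first holds in any double category `X`. Once companions `f_!` and `g_!` are fixed, a cell `f_! ⟶
g_!` with sides `a`, `b` carries the same information as a cell between external identities with
left side `a ≫ g` and right side `f ≫ b`. One passage composes with the unit of `f_!` and the counit
of `g_!`, and `Companion.lift` is its inverse (`Companion.unit_lift_counit`, `Companion.eq_lift`).
Cells of the second kind are exactly quintets. So a choice of a companion for every arrow in a class
`W` sends quintets, read with arrows and proarrows interchanged, to cells of `X`. Both compositions
of quintets are respected (`Companion.lift_comp`, `Companion.hsq_lift`), the external one up to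
replacing the composite of two chosen companions by the chosen companion of the composite. The
comparison cells of the double functor make that replacement. Their coherence needs no diagram
chase: a cell between companions that is globular and respects units is unique and invertible
(`Companion.IsComparison`), and both sides of each coherence law are such cells.

The second fact produces companions in `LaxOpl D E`. If the components of `α : F ⟶ G` have
companions, these are the components of a protransformation. Its cell at an arrow corresponds to the
naturality square of `α`, and its comparison at a proarrow `m` is the `slide` of the component cell
`α_m`. The axioms follow because a slide is determined by its composite with a unit; this makes
sliding natural (`slide_naturality`) and compatible with external composites and identities
(`slide_hcomp`, `slide_hidSq`). The units and counits of the component companions assemble into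
modifications, and the companion equations hold componentwise.

The first functor is the first fact applied to these companions. If all component cells of `α` are
commuters, every slide is invertible whichever companions were chosen (`IsCommuter.isIso_slide`), so
the protransformation is pseudo and the same construction lands in `LaxPs D E`. -/

namespace DoubleCategory

/-! ### Cells between companions and their correspondence with quintets -/

section companionCells

variable {X : DoubleCategory.{u, v, w, t}}

/-- Cells out of `m ⊙ f_!` are determined by their right side and their composite with the unit. -/
lemma Companion.hcomp_hom_ext {x y z : X.Obj} {m : X.Pro x y} {f : y ⟶ z} (c : Companion f)
    {x' z' : X.Obj} {n : X.Pro x' z'} {β β' : X.Sq (X.hcomp m c.pro) n}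
    (hr : X.right β = X.right β')
    (h : X.hsq (X.one m) c.unit (by simp) ≫ β = X.hsq (X.one m) c.unit (by simp) ≫ β') :
    β = β' := by
  have key (γ : X.Sq (X.hcomp m c.pro) n) : γ =
      X.hsq (X.one m) (X.lunit c.pro).inv (by simp) ≫ (X.assoc _ _ _).inv ≫
        X.hsq (X.hsq (X.one m) c.unit (by simp) ≫ γ) (c.counit ≫ X.hidSq (X.right γ)) (by simp) ≫
        (X.runit n).hom := by
    -- The companion identity for `f_!`, whiskered by `m`, is placed before `γ`. Moving `γ` through
    -- the right unitor then leaves `γ` visible only through its composite with the unit and through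
    -- its right side.
    have e₁ : X.hsq (X.one m) (X.lunit c.pro).inv (by simp) ≫
        X.hsq (X.one m) (X.hsq c.unit c.counit (by simp)) (by simp) ≫
        X.hsq (X.one m) (X.runit c.pro).hom (by simp) = 𝟙 _ := by
      rw [hsq_hsq, hsq_hsq]
      exact hsq_eq_one _ (by simp) c.hsq_unit_counit
    rw [X.hsq_comp _ _ (by simp) _ _ (by simp), Category.assoc, X.runit_naturality γ,
      ← assoc_inv_naturality_assoc _ _ _ (by simp) (by simp),
      ← Category.assoc (X.assoc _ _ _).inv, runit_hcomp, ← Category.assoc, ← Category.assoc,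
      Category.assoc (X.hsq _ _ _), e₁, Category.id_comp]
  rw [key β, key β']
  simp only [h, hr]

/-- Cells into `f_!` are determined by their left side and their composite with the counit. -/
lemma Companion.hom_ext_counit {x y : X.Obj} {f : x ⟶ y} (c : Companion f)
    {x' z' : X.Obj} {n : X.Pro x' z'} {β β' : X.Sq n c.pro}
    (hl : X.left β = X.left β') (h : β ≫ c.counit = β' ≫ c.counit) : β = β' := by
  -- The companion identity is placed after `γ`, and `γ` is moved through the left unitor. The left
  -- side of `γ` appears because naturality of that unitor introduces the external identity on it.
  have key (γ : X.Sq n c.pro) : γ = (X.lunit n).inv ≫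
      X.hsq (X.hidSq (X.left γ) ≫ c.unit) (γ ≫ c.counit) (by simp) ≫ (X.runit c.pro).hom := by
    rw [X.hsq_comp _ _ (by simp) _ _ (by simp), Category.assoc, ← lunit_inv_naturality_assoc,
      c.hsq_unit_counit, Category.comp_id]
  rw [key β, key β']
  simp only [h, hl]

/-- Cells out of `f_!` are determined by their right side and their composite with the unit. -/
lemma Companion.hom_ext_unit {x y : X.Obj} {f : x ⟶ y} (c : Companion f)
    {x' z' : X.Obj} {n : X.Pro x' z'} {β β' : X.Sq c.pro n}
    (hr : X.right β = X.right β') (h : c.unit ≫ β = c.unit ≫ β') : β = β' := by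
  have key (γ : X.Sq c.pro n) : γ = (X.lunit c.pro).inv ≫
      X.hsq (c.unit ≫ γ) (c.counit ≫ X.hidSq (X.right γ)) (by simp) ≫ (X.runit n).hom := by
    rw [X.hsq_comp _ _ (by simp) _ _ (by simp), Category.assoc, X.runit_naturality,
      ← Category.assoc (X.hsq _ _ _), ← Category.assoc, c.hsq_unit_counit, Category.id_comp]
  rw [key β, key β']
  simp only [h, hr]

variable {x y x' y' x'' y'' : X.Obj} {f : x ⟶ y} {f' : x' ⟶ y'} {f'' : x'' ⟶ y''}

/-- This is the injectivity half of the correspondence between cells of companions and quintets.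
`Companion.unit_lift_counit` is the surjectivity half. -/
lemma Companion.hom_ext (c : Companion f) (c' : Companion f') {β β' : X.Sq c.pro c'.pro}
    (hl : X.left β = X.left β') (hr : X.right β = X.right β')
    (h : c.unit ≫ β ≫ c'.counit = c.unit ≫ β' ≫ c'.counit) : β = β' :=
  c.hom_ext_unit hr (c'.hom_ext_counit (by simp [hl]) (by simpa using h))

/-- The cell between companions that corresponds to a cell `a ≫ f' ⇛ f ≫ b`. -/
def Companion.lift (c : Companion f) (c' : Companion f') {a : x ⟶ x'} {b : y ⟶ y'}
    (θ : X.Sq (X.hid x) (X.hid y')) (hl : X.left θ = a ≫ f') (hr : X.right θ = f ≫ b) :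
    X.Sq c.pro c'.pro :=
  (X.lunit c.pro).inv ≫
    X.hsq (X.lunit (X.hid x)).inv (X.one c.pro) (by simp) ≫
    X.hsq (X.hsq (X.hidSq a ≫ c'.unit) θ (by simp [hl])) (c.counit ≫ X.hidSq b) (by simp [hr]) ≫
    X.hsq (X.runit c'.pro).hom (X.one (X.hid y')) (by simp) ≫ (X.runit c'.pro).hom

section

variable (c : Companion f) (c' : Companion f') (c'' : Companion f'') {a : x ⟶ x'} {b : y ⟶ y'}
  {θ : X.Sq (X.hid x) (X.hid y')} (hl : X.left θ = a ≫ f') (hr : X.right θ = f ≫ b)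

@[simp] lemma Companion.left_lift : X.left (c.lift c' θ hl hr) = a := by simp [lift]

@[simp] lemma Companion.right_lift : X.right (c.lift c' θ hl hr) = b := by simp [lift]

lemma Companion.unit_lift_counit : c.unit ≫ c.lift c' θ hl hr ≫ c'.counit = θ := by
  -- Naturality of the right unitor brings `c'.counit` next to `c'.unit`, and the two collapse to an
  -- external identity.
  have e₁ : X.hsq (X.hidSq a ≫ c'.unit) θ (by simp [hl]) ≫ (X.runit c'.pro).hom ≫ c'.counit =
      X.hsq (X.hidSq (a ≫ f')) θ (by simp [hl]) ≫ (X.lunit (X.hid y')).hom := by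
    rw [← runit_naturality' c'.counit c'.right_counit, ← Category.assoc, hsq_hsq, unitors_hid]
    congr 1
    refine hsq_congr _ ?_ (by simp)
    rw [Category.assoc, c'.unit_counit, hidSq_comp]
  -- Likewise `c.unit` moves through the left unitor and meets `c.counit`. What remains is `θ`
  -- between two external identity cells, which are neutral for `spComp`.
  have e₂ : c.unit ≫ c.lift c' θ hl hr ≫ c'.counit =
      spComp (spComp (X.hidSq (a ≫ f')) θ (by simp [hl])) (X.hidSq (f ≫ b)) (by simp [hr]) := by
    unfold lift spComp
    simp only [Category.assoc]
    rw [lunit_inv_naturality_assoc, ← runit_naturality' c'.counit c'.right_counit,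
      hsq_hsq_assoc, hsq_hsq_assoc, hsq_hsq_assoc, hsq_hsq_assoc, ← unitors_hid]
    congr 2
    refine hsq_congr _ ?_ ?_
    · simp only [left_unit, hidSq_id, Category.id_comp, Category.assoc]
      rw [e₁]
    · simp only [Category.comp_id, hidSq_id, hidSq_comp]
      rw [← Category.assoc, c.unit_counit]
  rw [e₂]
  exact (spComp_congr _ (hid_spComp _ hl) rfl).trans (spComp_hid _ hr)

lemma Companion.eq_lift {β : X.Sq c.pro c'.pro} (hβ : X.left β = a) (hβ' : X.right β = b)
    (h : c.unit ≫ β ≫ c'.counit = θ) : β = c.lift c' θ hl hr :=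
  c.hom_ext c' (by simp [hβ]) (by simp [hβ']) (by rw [h, unit_lift_counit])

/-- The right-hand cell is the external composite of quintets, which becomes internal composition
after transposing. It arises by inserting the companion identity of `c'` between the two lifts: the
unit of `c'` is absorbed by the second lift and its counit by the first. -/
lemma Companion.lift_comp {a' : x' ⟶ x''} {b' : y' ⟶ y''} {θ' : X.Sq (X.hid x') (X.hid y'')}
    (hl' : X.left θ' = a' ≫ f'') (hr' : X.right θ' = f' ≫ b') :
    c.lift c' θ hl hr ≫ c'.lift c'' θ' hl' hr' =
      c.lift c'' (a := a ≫ a') (b := b ≫ b')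
        (spComp (X.hidSq a ≫ θ') (θ ≫ X.hidSq b') (by simp [hr', hl])) (by simp [hl'])
        (by simp [hr]) := by
  refine c.eq_lift c'' _ _ (by simp) (by simp) ?_
  have e := c.unit_lift_counit c' hl hr
  have e' := c'.unit_lift_counit c'' hl' hr'
  unfold spComp
  -- An identity cell on `c'.pro` is created here so that it can be expanded by the companion
  -- identity.
  rw [← Category.id_comp (c'.lift c'' θ' hl' hr')]
  change _ ≫ (_ ≫ X.one c'.pro ≫ _) ≫ _ = _
  rw [← c'.hsq_unit_counit]
  simp only [Category.assoc]
  rw [← runit_naturality'_assoc (c'.lift c'' θ' hl' hr') (f := b') (by simp),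
    ← runit_naturality' c''.counit c''.right_counit, lunit_inv_naturality_assoc (c.lift _ _ _ _),
    lunit_inv_naturality_assoc, hsq_hsq_assoc, hsq_hsq_assoc, hsq_hsq_assoc, hsq_hsq_assoc,
    unitors_hid]
  congr 2
  refine hsq_congr _ ?_ ?_
  · simp only [left_unit, left_lift, hidSq_id, Category.id_comp, Category.assoc]
    rw [e']
  · simp only [hidSq_id, Category.comp_id, Category.assoc]
    simpa only [Category.assoc] using congrArg (· ≫ X.hidSq b') e

end

/-! ### Comparisons between companions, and coherence by uniqueness -/

/-- A cell between companions, with right side an identity, that respects the units. -/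
structure Companion.IsComparison {x y : X.Obj} {f f' : x ⟶ y} (c : Companion f)
    (c' : Companion f') (χ : X.Sq c.pro c'.pro) : Prop where
  left : X.left χ = 𝟙 x
  right : X.right χ = 𝟙 y
  unit : c.unit ≫ χ = c'.unit

/-- The comparison between two companions of an arrow. -/
def Companion.comparison {x y : X.Obj} {f f' : x ⟶ y} (c : Companion f) (c' : Companion f')
    (e : f = f') : X.Sq c.pro c'.pro :=
  c.lift c' (a := 𝟙 x) (b := 𝟙 y) (X.hidSq f) (by simp [e]) (by simp)

namespace Companion.IsComparison

variable {x y z a : X.Obj} {f f' f'' : x ⟶ y} {c : Companion f} {c' : Companion f'}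
  {c'' : Companion f''}

/-- All coherence laws of the double functor reduce to this: each side is shown to be a comparison
between the same two companions. -/
lemma unique {χ χ' : X.Sq c.pro c'.pro} (h : c.IsComparison c' χ) (h' : c.IsComparison c' χ') :
    χ = χ' :=
  c.hom_ext_unit (h.right.trans h'.right.symm) (h.unit.trans h'.unit.symm)

/-- Comparisons are allowed between companions of syntactically different arrows, such as the two
bracketings of a triple composite. Equality of the arrows is recovered from the right sides of the
units. -/
lemma eq {χ : X.Sq c.pro c'.pro} (h : c.IsComparison c' χ) : f = f' := by
  have := congrArg X.right h.unit
  simpa [h.right] using this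

lemma one : c.IsComparison c (X.one c.pro) := ⟨by simp, by simp, by simp⟩

lemma comp {χ : X.Sq c.pro c'.pro} {χ' : X.Sq c'.pro c''.pro} (h : c.IsComparison c' χ)
    (h' : c'.IsComparison c'' χ') : c.IsComparison c'' (χ ≫ χ') :=
  ⟨by simp [h.left, h'.left], by simp [h.right, h'.right],
    by rw [← Category.assoc, h.unit, h'.unit]⟩

/-- Compatibility with counits need not be part of the definition: after composing with the unit,
both sides are the same external identity cell. -/
lemma counit {χ : X.Sq c.pro c'.pro} (h : c.IsComparison c' χ) : χ ≫ c'.counit = c.counit := by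
  refine c.hom_ext_unit (by simp [h.right]) ?_
  rw [← Category.assoc, h.unit, c'.unit_counit, c.unit_counit, h.eq]

lemma of_comparison (c : Companion f) (c' : Companion f') (e : f = f') :
    c.IsComparison c' (c.comparison c' e) := by
  unfold comparison
  refine ⟨by simp, by simp, c'.hom_ext_counit (by simp) ?_⟩
  rw [Category.assoc, unit_lift_counit, c'.unit_counit, e]

/-- There is also a comparison in the opposite direction, and both round trips are self-comparisons,
hence identities by uniqueness. -/
lemma isIso {χ : X.Sq c.pro c'.pro} (h : c.IsComparison c' χ) : IsIso χ := by
  have h' := of_comparison c' c h.eq.symm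
  exact ⟨_, (h.comp h').unique one, (h'.comp h).unique one⟩

/-- By `comp_unit` the unit of a composite companion is an external composite up to a unitor, so
compatibility with units can be checked factor by factor. -/
lemma hsq {g g' : y ⟶ z} {d : Companion g} {d' : Companion g'} {χ : X.Sq c.pro c'.pro}
    {χ' : X.Sq d.pro d'.pro} (h : c.IsComparison c' χ) (h' : d.IsComparison d' χ') :
    (c.comp d).IsComparison (c'.comp d') (X.hsq χ χ' (by rw [h.right, h'.left])) := by
  refine ⟨(X.left_hsq _ _ _).trans h.left, (X.right_hsq _ _ _).trans h'.right, ?_⟩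
  rw [comp_unit, comp_unit]
  refine (Category.assoc _ _ _).trans (congrArg (_ ≫ ·) ((hsq_hsq _ _ _ _ _ _).trans ?_))
  refine hsq_congr _ h.unit ?_
  rw [Category.assoc, h'.unit, h.eq]

/-- Together with `runit` and `assoc`, this says that the structure cells of the double category are
themselves comparisons between composite companions. That puts them within reach of `unique`. -/
lemma lunit (c : Companion f) : ((Companion.id x).comp c).IsComparison c (X.lunit c.pro).hom := by
  refine ⟨X.left_lunit _, X.right_lunit _, ?_⟩
  rw [comp_unit]
  refine (Category.assoc _ _ _).trans ?_
  change _ ≫ X.hsq (X.one _) (X.hidSq _ ≫ c.unit) _ ≫ _ = _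
  have := lunit_naturality' (X.hidSq (𝟙 x) ≫ c.unit) (f := 𝟙 x) (by simp)
  rw [hsq_congr _ (X.hidSq_id x) rfl] at this
  rw [this, Iso.inv_hom_id_assoc, hidSq_id, Category.id_comp]

lemma runit (c : Companion f) : (c.comp (Companion.id y)).IsComparison c (X.runit c.pro).hom := by
  refine ⟨X.left_runit _, X.right_runit _, ?_⟩
  change (c.unit ≫ (X.runit c.pro).inv ≫ X.hsq (X.one c.pro) (X.one _) _) ≫ _ = _
  rw [hsq_one]
  simp

lemma assoc {g : y ⟶ z} {k : z ⟶ a} (c : Companion f) (d : Companion g) (e : Companion k) :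
    ((c.comp d).comp e).IsComparison (c.comp (d.comp e)) (X.assoc c.pro d.pro e.pro).hom := by
  refine ⟨X.left_assoc _ _ _, X.right_assoc _ _ _, ?_⟩
  change ((c.unit ≫ (X.runit c.pro).inv ≫ X.hsq (X.one c.pro) d.unit _) ≫
      (X.runit (X.hcomp c.pro d.pro)).inv ≫ X.hsq (X.one (X.hcomp c.pro d.pro)) e.unit _) ≫ _ =
    c.unit ≫ (X.runit c.pro).inv ≫ X.hsq (X.one c.pro)
      (d.unit ≫ (X.runit d.pro).inv ≫ X.hsq (X.one d.pro) e.unit _) _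
  -- Splitting the identity of the composite proarrow exposes a threefold external composite, to
  -- which naturality of the associator applies.
  have h₁ : X.hsq (X.one (X.hcomp c.pro d.pro)) e.unit (by simp) =
      X.hsq (X.hsq (X.one c.pro) (X.one d.pro) (by simp)) e.unit (by simp) :=
    hsq_congr _ (X.hsq_one _ _).symm rfl
  have h₂ : (X.runit (X.hcomp c.pro d.pro)).inv ≫ (X.assoc _ _ _).hom =
      X.hsq (X.one c.pro) (X.runit d.pro).inv (by simp) := by
    have := isIso_hsq (X.one c.pro) (X.runit d.pro).hom (by simp)
    rw [Iso.inv_comp_eq, ← cancel_mono (X.hsq (X.one c.pro) (X.runit d.pro).hom (by simp)),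
      Category.assoc, hsq_hsq, hsq_eq_one _ (by simp) (by simp), Category.comp_id,
      ← runit_hcomp, Iso.hom_inv_id_assoc]
  simp only [Category.assoc]
  rw [h₁, X.assoc_naturality _ _ _ (by simp) (by simp), reassoc_of% h₂, hsq_hsq, hsq_hsq]
  congr 2
  exact hsq_congr _ (by simp) (by simp)

end Companion.IsComparison

/-- Lifting does not depend on the companions, up to comparison: comparisons respect units and
counits, so both sides correspond to the same cell `θ`. The naturality laws of the double functor
come from here. -/
lemma Companion.lift_comparison {x y x' y' : X.Obj} {f : x ⟶ y} {f' : x' ⟶ y'} (c d : Companion f)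
    (c' d' : Companion f') {a : x ⟶ x'} {b : y ⟶ y'} {θ : X.Sq (X.hid x) (X.hid y')}
    (hl : X.left θ = a ≫ f') (hr : X.right θ = f ≫ b) :
    c.lift c' θ hl hr ≫ c'.comparison d' rfl = c.comparison d rfl ≫ d.lift d' θ hl hr := by
  have h := IsComparison.of_comparison c d rfl
  have h' := IsComparison.of_comparison c' d' rfl
  refine c.hom_ext d' (by simp [h.left, h'.left]) (by simp [h.right, h'.right]) ?_
  rw [Category.assoc, h'.counit, unit_lift_counit, Category.assoc, ← Category.assoc, h.unit,
    unit_lift_counit]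

lemma Companion.lift_id {x y : X.Obj} (f : x ⟶ y) :
    (Companion.id x).lift (Companion.id y) (a := f) (b := f) (X.hidSq f) (by simp) (by simp) =
      X.hidSq f :=
  ((Companion.id x).eq_lift (Companion.id y) _ _ (X.left_hidSq f) (X.right_hidSq f)
    ((Category.id_comp _).trans (Category.comp_id _))).symm

lemma Companion.comp_counit {x y z : X.Obj} {f : x ⟶ y} {g : y ⟶ z} (cf : Companion f)
    (cg : Companion g) : (cf.comp cg).counit =
      X.hsq (cf.counit ≫ X.hidSq g) cg.counit (by simp) ≫ (X.lunit (X.hid z)).hom := by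
  change X.hsq cf.counit (X.one cg.pro) _ ≫ (X.lunit cg.pro).hom ≫ cg.counit = _
  rw [← lunit_naturality' cg.counit cg.left_counit, ← Category.assoc, hsq_hsq]
  congr 1
  exact hsq_congr _ rfl (Category.id_comp _)

/-- The right-hand cell is the internal composite of quintets. With the unit and counit of a
composite companion written as external composites, interchange reduces the claim to one
unit–lift–counit computation in each factor. -/
lemma Companion.hsq_lift {x₁ x₂ x₃ y₁ y₂ y₃ : X.Obj} {f : x₁ ⟶ x₂} {g : x₂ ⟶ x₃} {f' : y₁ ⟶ y₂}
    {g' : y₂ ⟶ y₃} (cf : Companion f) (cg : Companion g) (cf' : Companion f')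
    (cg' : Companion g') {a : x₁ ⟶ y₁} {b : x₂ ⟶ y₂} {c : x₃ ⟶ y₃}
    {θ : X.Sq (X.hid x₁) (X.hid y₂)} {θ' : X.Sq (X.hid x₂) (X.hid y₃)}
    (hl : X.left θ = a ≫ f') (hr : X.right θ = f ≫ b) (hl' : X.left θ' = b ≫ g')
    (hr' : X.right θ' = g ≫ c) :
    X.hsq (cf.lift cf' θ hl hr) (cg.lift cg' θ' hl' hr') (by simp) =
      (cf.comp cg).lift (cf'.comp cg') (a := a) (b := c)
        (spComp (θ ≫ X.hidSq g') (X.hidSq f ≫ θ') (by simp [hr, hl'])) (by simp [hl])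
        (by simp [hr']) := by
  refine eq_lift (cf.comp cg) (cf'.comp cg') _ _ ((X.left_hsq _ _ _).trans (by simp))
    ((X.right_hsq _ _ _).trans (by simp)) ?_
  rw [comp_unit, comp_counit]
  refine (Category.assoc _ _ _).trans (congrArg (_ ≫ ·) ?_)
  refine (hsq_hsq_assoc _ _ _ _ _ _ _).trans ((hsq_hsq_assoc _ _ _ _ _ _ _).trans ?_)
  refine congrArg (· ≫ _) (hsq_congr _ ?_ ?_)
  · simpa only [Category.assoc] using
      congrArg (· ≫ X.hidSq g') (cf.unit_lift_counit cf' hl hr)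
  · simpa only [Category.assoc] using
      congrArg (X.hidSq f ≫ ·) (cg.unit_lift_counit cg' hl' hr')

end companionCells

/-! ### The double functor defined by a choice of companions -/

section quintetFunctor

variable {X : DoubleCategory.{u, v, w, t}} {W : ∀ ⦃x y : X.Obj⦄, (x ⟶ y) → Prop}

namespace Quintet

/-- The cell between companions that corresponds to a quintet. -/
def toSq {x y x' y' : X.Obj} (q : Quintet X W x y x' y') {f : {f : x ⟶ x' // W f}}
    {g : {g : y ⟶ y' // W g}} (hf : q.left = f) (hg : q.right = g) (cf : Companion f.1)
    (cg : Companion g.1) : X.Sq cf.pro cg.pro :=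
  cf.lift cg (a := q.top) (b := q.bot) q.sq (by simp [hg]) (by simp [hf])

/-- The coherence cells of the strict source are identity quintets between equal, but not
definitionally equal, arrows. This turns their images into comparisons, so they too fall under
`IsComparison.unique`. -/
lemma isComparison_toSq {x y : X.Obj} (q : Quintet X W x x y y) {f g : {f : x ⟶ y // W f}}
    (hf : q.left = f) (hg : q.right = g) (cf : Companion f.1) (cg : Companion g.1)
    (ht : q.top = 𝟙 x) (hb : q.bot = 𝟙 y) (hs : q.sq = X.hidSq f.1) :
    cf.IsComparison cg (q.toSq hf hg cf cg) := by
  obtain ⟨top, bot, left, right, sq, hl, hr⟩ := q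
  dsimp only at hf hg ht hb hs
  subst hf hg ht hb hs
  -- Both sides of an external identity cell are the same arrow; with identity top, the left
  -- boundary equation reads exactly this.
  have e : left.1 = right.1 := by simpa using hl
  exact Companion.IsComparison.of_comparison _ _ e

variable {hW : ∀ x, W (𝟙 x)}
  {hW' : ∀ ⦃x y z : X.Obj⦄ (f : x ⟶ y) (g : y ⟶ z), W f → W g → W (f ≫ g)}

lemma toSq_hcomp {x y z x' y' z' : X.Obj} (α : Quintet X W x y x' y') (β : Quintet X W y z y' z')
    {f : {f : x ⟶ x' // W f}} {g : {g : y ⟶ y' // W g}} {k : {k : z ⟶ z' // W k}}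
    (hf : α.left = f) (hg : α.right = g) (hg' : β.left = g) (hk : β.right = k)
    (cf : Companion f.1) (cg : Companion g.1) (ck : Companion k.1) (h : α.right = β.left) :
    toSq ((quintets X W hW hW').hcomp α β h) hf hk cf ck =
      α.toSq hf hg cf cg ≫ β.toSq hg' hk cg ck :=
  (Companion.lift_comp _ _ _ _ _ _ _).symm

/-- This is naturality of the comparison for external composition, since internal composition of
quintets becomes external in the transpose. The companions `d`, `d'` stand for the ones chosen for
the composites. -/
lemma toSq_vcomp {x y x' y' x'' y'' : X.Obj} (α : Quintet X W x y x' y')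
    (β : Quintet X W x' y' x'' y'') {f : {f : x ⟶ x' // W f}} {g : {g : y ⟶ y' // W g}}
    {f' : {f : x' ⟶ x'' // W f}} {g' : {g : y' ⟶ y'' // W g}}
    (hf : α.left = f) (hg : α.right = g) (hf' : β.left = f') (hg' : β.right = g')
    (cf : Companion f.1) (cg : Companion g.1) (cf' : Companion f'.1) (cg' : Companion g'.1)
    (h : α.bot = β.top) {χ : X.Sq cf.pro cg.pro} (hχ : χ = α.toSq hf hg cf cg)
    {χ' : X.Sq cf'.pro cg'.pro} (hχ' : χ' = β.toSq hf' hg' cf' cg')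
    (hh : X.right χ = X.left χ')
    (d : Companion (f.1 ≫ f'.1)) (d' : Companion (g.1 ≫ g'.1)) :
    X.hsq χ χ' hh ≫ (cg.comp cg').comparison d' rfl =
      (cf.comp cf').comparison d rfl ≫
        toSq (f := ⟨_, hW' _ _ f.2 f'.2⟩) (g := ⟨_, hW' _ _ g.2 g'.2⟩)
          ((quintets X W hW hW').vcomp α β h) (by subst hf hf'; rfl) (by subst hg hg'; rfl)
          d d' := by
  obtain ⟨top, bot, left, right, sq, hl, hr⟩ := α
  obtain ⟨top', bot', left', right', sq', hl', hr'⟩ := β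
  dsimp only at hf hg hf' hg' h
  -- Boundaries agree only through equations; substituting them makes the two cells literally lifts
  -- with a shared side, as `Companion.hsq_lift` requires.
  subst hf hg hf' hg' h hχ hχ'
  refine (congrArg (· ≫ _) (Companion.hsq_lift cf cf' cg cg' hl hr hl' hr')).trans ?_
  exact Companion.lift_comparison _ _ _ _ _ _

end Quintet

variable (hW : ∀ x, W (𝟙 x))
  (hW' : ∀ ⦃x y z : X.Obj⦄ (f : x ⟶ y) (g : y ⟶ z), W f → W g → W (f ≫ g))
  (c : ∀ ⦃x y : X.Obj⦄ (f : {f : x ⟶ y // W f}), Companion f.1)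

open Quintet Companion in
/-- A choice of companions for the arrows in `W` defines a double functor on the transpose of the
double category of quintets. -/
def quintetFunctor : DoubleFunctor (quintets X W hW hW').transpose.toDouble X where
  obj x := x
  map f := f
  map_id _ := rfl
  map_comp _ _ := rfl
  pro {x y} f := (c (x := x) (y := y) f).pro
  sq {x y x' y' m n} α := toSq (X := X) (W := W) α.1 α.2.1 α.2.2 (c m) (c n)
  left_sq α := left_lift _ _ _ _
  right_sq α := right_lift _ _ _ _
  sq_one m := (isComparison_toSq (X := X) _ _ _ _ _ rfl rfl rfl).unique .one
  sq_comp {x y x' y' x'' y'' m n p} α β :=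
    toSq_hcomp (hW := hW) (hW' := hW') α.1 β.1 α.2.1 α.2.2 β.2.1 β.2.2 (c m) (c n) (c p)
      (α.2.2.trans β.2.1.symm)
  lax {x y z} m n := ((c m).comp (c n)).comparison (c ⟨m.1 ≫ n.1, hW' _ _ m.2 n.2⟩) rfl
  left_lax m n := (IsComparison.of_comparison _ _ _).left
  right_lax m n := (IsComparison.of_comparison _ _ _).right
  unit x := (Companion.id (X := X) x).comparison (c ⟨𝟙 (show X.Obj from x), hW x⟩) rfl
  left_unit x := (IsComparison.of_comparison _ _ _).left
  right_unit x := (IsComparison.of_comparison _ _ _).right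
  lax_naturality {x y z x' y' z' m n m' n'} α β h :=
    toSq_vcomp (hW := hW) (hW' := hW') α.1 β.1 α.2.1 α.2.2 β.2.1 β.2.2 (c m) (c m') (c n)
      (c n') h rfl rfl _ _ _
  unit_naturality f :=
    -- An external identity cell is the lift between identity companions, so naturality of the unit
    -- comparison is a change of companions.
    (congrArg (· ≫ _) (lift_id (X := X) f).symm).trans (lift_comparison (X := X) _ _ _ _ _ _)
  -- Both sides compare the left-bracketed composite of chosen companions with the chosen companion
  -- of the right-bracketed composite. The unit laws below have the same form.
  lax_assoc {x y z a} m n p := IsComparison.unique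
    ((IsComparison.hsq (.of_comparison _ _ _) .one).comp ((IsComparison.of_comparison _ _ _).comp
      (isComparison_toSq (X := X) (W := W) _ _ _ _ (c _) rfl rfl rfl)))
    ((IsComparison.assoc (c m) (c n) (c p)).comp
      ((IsComparison.hsq .one (.of_comparison _ _ _)).comp (.of_comparison _ _ _)))
  lax_lunit {x y} m := IsComparison.unique
    ((IsComparison.hsq (.of_comparison _ _ _) .one).comp ((IsComparison.of_comparison _ _ _).comp
      (isComparison_toSq (X := X) (W := W) _ _ _ _ (c _) rfl rfl rfl)))
    (IsComparison.lunit (c m))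
  lax_runit {x y} m := IsComparison.unique
    ((IsComparison.hsq .one (.of_comparison _ _ _)).comp ((IsComparison.of_comparison _ _ _).comp
      (isComparison_toSq (X := X) (W := W) _ _ _ _ (c _) rfl rfl rfl)))
    (IsComparison.runit (c m))
  isIso_lax m n := (IsComparison.of_comparison _ _ _).isIso
  isIso_unit x := (IsComparison.of_comparison _ _ _).isIso

end quintetFunctor

/-! ### Naturality and compositionality of sliding -/

section companionCells

variable {X : DoubleCategory.{u, v, w, t}}

section

variable {x y x' y' : X.Obj} {f : x ⟶ y} {f' : x' ⟶ y'} (c : Companion f) (c' : Companion f')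
  {a : x ⟶ x'} {b : y ⟶ y'}

/-- The cell between companions that corresponds to a commutative square of arrows. -/
def Companion.map (e : a ≫ f' = f ≫ b) : X.Sq c.pro c'.pro :=
  c.lift c' (a := a) (b := b) (X.hidSq (a ≫ f')) (by simp) (by simp [e])

@[simp] lemma Companion.left_map (e : a ≫ f' = f ≫ b) : X.left (c.map c' e) = a :=
  left_lift _ _ _ _

@[simp] lemma Companion.right_map (e : a ≫ f' = f ≫ b) : X.right (c.map c' e) = b :=
  right_lift _ _ _ _

/-- With `map_counit`, this supplies the internal equivariance of the unit and counit modifications.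
-/
lemma Companion.unit_map (e : a ≫ f' = f ≫ b) : c.unit ≫ c.map c' e = X.hidSq a ≫ c'.unit := by
  refine c'.hom_ext_counit (by simp) ?_
  rw [Category.assoc, Category.assoc, c'.unit_counit, ← hidSq_comp]
  exact c.unit_lift_counit c' _ _

lemma Companion.map_counit (e : a ≫ f' = f ≫ b) :
    c.map c' e ≫ c'.counit = c.counit ≫ X.hidSq b := by
  refine c.hom_ext_unit (by simp) ?_
  rw [← Category.assoc, ← Category.assoc, c.unit_counit, ← hidSq_comp, ← e, Category.assoc]
  exact c.unit_lift_counit c' _ _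

end

variable {x y x' y' : X.Obj} {m : X.Pro x y} {n : X.Pro x' y'} {f : x ⟶ x'} {g : y ⟶ y'}

lemma hsq_unit_slide {z z' : X.Obj} {p : X.Pro z z'} {a : z ⟶ x} {b : z' ⟶ y}
    (cf : Companion f) (cg : Companion g) (α : X.Sq m n) (hf : X.left α = f)
    (hg : X.right α = g) (β : X.Sq p m) (ha : X.left β = a) (hb : X.right β = b) :
    X.hsq β (X.hidSq b ≫ cg.unit) (by simp [hb]) ≫ slide cf cg α hf hg =
      ((X.runit p).hom ≫ (X.lunit p).inv) ≫
        X.hsq (X.hidSq a ≫ cf.unit) (β ≫ α) (by simp [ha, hf]) := by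
  have h : X.hsq β (X.hidSq b ≫ cg.unit) (by simp [hb]) =
      X.hsq β (X.hidSq b) (by simp [hb]) ≫ X.hsq (X.one m) cg.unit (by simp) := by
    rw [hsq_hsq]; exact hsq_congr _ (by simp) rfl
  rw [h, Category.assoc, unit_slide, ← Category.assoc, OplaxProtrans.idSq_naturality β ha hb,
    Category.assoc, hsq_hsq]

@[simp] lemma left_slide (cf : Companion f) (cg : Companion g) (α : X.Sq m n) (hf : X.left α = f)
    (hg : X.right α = g) : X.left (slide cf cg α hf hg) = 𝟙 x := by
  simp [slide]

@[simp] lemma right_slide (cf : Companion f) (cg : Companion g) (α : X.Sq m n) (hf : X.left α = f)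
    (hg : X.right α = g) : X.right (slide cf cg α hf hg) = 𝟙 y' := by
  simp [slide]

/-- The unit of `f_!` inside the slide cancels against the counit, leaving only `α` and unitors.
This is external equivariance for the counit modification, as `unit_slide` is for the unit. -/
lemma slide_counit (cf : Companion f) (cg : Companion g) (α : X.Sq m n) (hf : X.left α = f)
    (hg : X.right α = g) :
    X.hsq α cg.counit (by simp [hg]) ≫ (X.runit n).hom ≫ (X.lunit n).inv =
      slide cf cg α hf hg ≫ X.hsq cf.counit (X.one n) (by simp) := by
  unfold slide
  simp only [Category.assoc]
  rw [← Category.assoc, lunit_inv_naturality, hsq_hsq, hsq_hsq]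
  congr 1
  refine hsq_congr _ ?_ (by simp)
  rw [Category.id_comp, cf.unit_counit]
  simp [hf]

/-- Cells out of `m ⊙ g_!` can be tested on the unit of `g_!`. There a slide becomes `α` beside the
unit of `f_!`, and the hypotheses match the two factors separately. -/
lemma slide_naturality {x₁ y₁ x₁' y₁' : X.Obj} {m₁ : X.Pro x₁ y₁} {n₁ : X.Pro x₁' y₁'}
    {f₁ : x₁ ⟶ x₁'} {g₁ : y₁ ⟶ y₁'} (cf : Companion f) (cg : Companion g) (α : X.Sq m n)
    (hf : X.left α = f) (hg : X.right α = g) (cf₁ : Companion f₁) (cg₁ : Companion g₁)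
    (α₁ : X.Sq m₁ n₁) (hf₁ : X.left α₁ = f₁) (hg₁ : X.right α₁ = g₁) (μ : X.Sq m m₁)
    (ν : X.Sq n n₁) (h : μ ≫ α₁ = α ≫ ν) (φ : X.Sq cf.pro cf₁.pro) (ψ : X.Sq cg.pro cg₁.pro)
    (hφ : X.right φ = X.left ν) (hψ : X.right μ = X.left ψ) (hψν : X.right ψ = X.right ν)
    (eφ : cf.unit ≫ φ = X.hidSq (X.left μ) ≫ cf₁.unit)
    (eψ : cg.unit ≫ ψ = X.hidSq (X.right μ) ≫ cg₁.unit) :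
    X.hsq μ ψ hψ ≫ slide cf₁ cg₁ α₁ hf₁ hg₁ = slide cf cg α hf hg ≫ X.hsq φ ν hφ := by
  refine cg.hcomp_hom_ext (by simp [hψν]) ?_
  rw [← Category.assoc, ← Category.assoc, unit_slide, hsq_hsq, Category.assoc, hsq_hsq,
    hsq_congr _ (Category.id_comp _) eψ, hsq_unit_slide _ _ _ _ _ _ rfl rfl,
    hsq_congr _ eφ h.symm]

lemma slide_naturality_of_globular {m₁ : X.Pro x y} {n₁ : X.Pro x' y'} (cf : Companion f)
    (cg : Companion g) (α : X.Sq m n) (hf : X.left α = f) (hg : X.right α = g) (α₁ : X.Sq m₁ n₁)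
    (hf₁ : X.left α₁ = f) (hg₁ : X.right α₁ = g) (μ : X.Sq m m₁) (ν : X.Sq n n₁)
    (h : μ ≫ α₁ = α ≫ ν) (ha : X.left μ = 𝟙 x) (hb : X.right μ = 𝟙 y) (ha' : X.left ν = 𝟙 x')
    (hb' : X.right ν = 𝟙 y') :
    X.hsq μ (X.one cg.pro) (by simp [hb]) ≫ slide cf cg α₁ hf₁ hg₁ =
      slide cf cg α hf hg ≫ X.hsq (X.one cf.pro) ν (by simp [ha']) :=
  slide_naturality cf cg α hf hg cf cg α₁ hf₁ hg₁ μ ν h _ _ _ _ (by simp [hb']) (by simp [ha])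
    (by simp [hb])

/-- Whether sliding gives an invertible cell does not depend on the choice of companions. -/
lemma IsCommuter.isIso_slide {α : X.Sq m n} (h : IsCommuter α) (cf : Companion f)
    (cg : Companion g) (hf : X.left α = f) (hg : X.right α = g) :
    IsIso (slide cf cg α hf hg) := by
  subst hf hg
  obtain ⟨cf', cg', h⟩ := h
  have hφ := Companion.IsComparison.of_comparison cf cf' rfl
  have hψ := Companion.IsComparison.of_comparison cg cg' rfl
  -- With identities on `m` and `n`, naturality relates the two slides through comparisons of
  -- companions, which are invertible.
  have e := slide_naturality cf cg α rfl rfl cf' cg' α rfl rfl (X.one m) (X.one n) (by simp)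
    (cf.comparison cf' rfl) (cg.comparison cg' rfl) (by simp [hφ.right]) (by simp [hψ.left])
    (by simp [hψ.right]) (by simp [hφ.unit])
    (by simp [hψ.unit])
  have := hφ.isIso
  have := hψ.isIso
  have := isIso_hsq (X.one m) (cg.comparison cg' rfl) (by simp [hψ.left])
  have := isIso_hsq (cf.comparison cf' rfl) (X.one n) (by simp [hφ.right])
  exact IsIso.of_isIso_fac_right e.symm

/-- The proof follows a unit through the pasting: the unit of `k_!` passes through the slide of `β`
and emerges as the unit of `g_!`, which passes through the slide of `α` and emerges as that of
`f_!`. By `eq_slide` this characterizes the slide of the external composite. -/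
lemma slide_hcomp {x y z x' y' z' : X.Obj} {m : X.Pro x y}
    {n : X.Pro y z} {m' : X.Pro x' y'} {n' : X.Pro y' z'} {f : x ⟶ x'} {g : y ⟶ y'} {k : z ⟶ z'}
    (cf : Companion f) (cg : Companion g) (ck : Companion k) (α : X.Sq m m') (β : X.Sq n n')
    (hf : X.left α = f) (hg : X.right α = g) (hg' : X.left β = g) (hk : X.right β = k) :
    slide cf ck (X.hsq α β (hg.trans hg'.symm)) (by simp [hf]) (by simp [hk]) =
      (X.assoc m n ck.pro).hom ≫
        X.hsq (X.one m) (slide cg ck β hg' hk) (by simp) ≫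
        (X.assoc m cg.pro n').inv ≫
        X.hsq (slide cf cg α hf hg) (X.one n') (by simp) ≫
        (X.assoc cf.pro m' n').hom := by
  symm
  refine eq_slide cf ck _ _ _ _ (by simp) ?_
  have h₁ : X.hsq (X.one (X.hcomp m n)) ck.unit (by simp) =
      X.hsq (X.hsq (X.one m) (X.one n) (by simp)) ck.unit (by simp) :=
    hsq_congr _ (X.hsq_one _ _).symm rfl
  have h₂ : X.hsq (X.one m) (((X.runit n).hom ≫ (X.lunit n).inv) ≫ X.hsq cg.unit β (by simp [hg']))
      (by simp) = X.hsq (X.one m) ((X.runit n).hom ≫ (X.lunit n).inv) (by simp) ≫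
        X.hsq (X.one m) (X.hsq cg.unit β (by simp [hg'])) (by simp) := by
    rw [hsq_hsq]; exact hsq_congr _ (by simp) rfl
  have h₃ : X.hsq (((X.runit m).hom ≫ (X.lunit m).inv) ≫ X.hsq cf.unit α (by simp [hf])) β
      (by simp [hg, hg']) = X.hsq ((X.runit m).hom ≫ (X.lunit m).inv) (X.one n) (by simp) ≫
        X.hsq (X.hsq cf.unit α (by simp [hf])) β (by simp [hg, hg']) := by
    rw [hsq_hsq]; exact hsq_congr _ rfl (by simp)
  -- The structure cells left behind involve no companion any more; their equality is pure coherence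
  -- in the underlying bicategory.
  have h₄ : (X.assoc m n (X.hid z)).hom ≫
      X.hsq (X.one m) ((X.runit n).hom ≫ (X.lunit n).inv) (by simp) ≫
      (X.assoc m (X.hid y) n).inv ≫
      X.hsq ((X.runit m).hom ≫ (X.lunit m).inv) (X.one n) (by simp) ≫
      (X.assoc (X.hid x) m n).hom =
      (X.runit (X.hcomp m n)).hom ≫ (X.lunit (X.hcomp m n)).inv := by
    have := (by intro a b c m n; bicategory :
      ∀ {a b c : Hor X} (m : a ⟶ b) (n : b ⟶ c),
      (Bicategory.associator m n (𝟙 c)).hom ≫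
        Bicategory.whiskerLeft m ((Bicategory.rightUnitor n).hom ≫
          (Bicategory.leftUnitor n).inv) ≫
        (Bicategory.associator m (𝟙 b) n).inv ≫
        Bicategory.whiskerRight ((Bicategory.rightUnitor m).hom ≫
          (Bicategory.leftUnitor m).inv) n ≫
        (Bicategory.associator (𝟙 a) m n).hom =
      (Bicategory.rightUnitor (m ≫ n)).hom ≫
        (Bicategory.leftUnitor (m ≫ n)).inv)
    exact congrArg Glob.sq (this (a := ⟨x⟩) (b := ⟨y⟩) (c := ⟨z⟩) m n)
  rw [h₁, X.assoc_naturality_assoc _ _ _ (by simp) (by simp), hsq_hsq_assoc,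
    hsq_congr _ (Category.comp_id _) (unit_slide cg ck β hg' hk), h₂, Category.assoc,
    assoc_inv_naturality_assoc _ _ _ (by simp) (by simp [hg']), hsq_hsq_assoc,
    hsq_congr _ (unit_slide cf cg α hf hg) (Category.comp_id _), h₃, Category.assoc,
    X.assoc_naturality _ _ _ (by simp [hf]) (by simp [hg, hg']), ← h₄]
  simp only [Category.assoc]

lemma slide_hidSq {x y : X.Obj} {f : x ⟶ y} (c : Companion f) :
    slide c c (X.hidSq f) (by simp) (by simp) = (X.lunit c.pro).hom ≫ (X.runit c.pro).inv := by
  symm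
  refine eq_slide c c _ _ _ _ (by simp) ?_
  have h := lunit_naturality' c.unit c.left_unit
  rw [hsq_congr _ (X.hidSq_id x) rfl] at h
  rw [← Category.assoc, h, Category.assoc, runit_inv_naturality, unitors_hid,
    Category.assoc, unitors_inv_hid]
  congr 2
  exact hsq_congr _ rfl (by simp)

end companionCells

/-! ### Protransformations of companions as companions of natural transformations -/

section protrans

variable {D : DoubleCategory.{u₁, v₁, w₁, t₁}} {E : DoubleCategory.{u₂, v₂, w₂, t₂}}
  {F G : LaxDoubleFunctor D E}

/-- The protransformation whose components are companions of the components of a natural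
transformation. -/
def OplaxProtrans.ofCompanions (α : F ⟶ G)
    (c : ∀ x : D.Obj, Companion (LaxDoubleFunctor.NatTrans.app α x)) : OplaxProtrans F G where
  app x := (c x).pro
  sq {x y} f := (c x).map (c y) (LaxDoubleFunctor.NatTrans.naturality α f)
  left_sq f := Companion.left_map _ _ _
  right_sq f := Companion.right_map _ _ _
  nat {x y} m := slide (c x) (c y) (LaxDoubleFunctor.NatTrans.sq α m)
    (LaxDoubleFunctor.NatTrans.left_sq α m) (LaxDoubleFunctor.NatTrans.right_sq α m)
  left_nat m := left_slide _ _ _ _ _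
  right_nat m := right_slide _ _ _ _ _
  -- Functoriality in arrows is tested on the unit, where each component cell becomes an external
  -- identity cell followed by a unit.
  sq_id x := (c x).hom_ext_unit (by simp) (by simp [Companion.unit_map])
  sq_comp {x y z} f g := (c x).hom_ext_unit (by simp) (by
    rw [Companion.unit_map, ← Category.assoc, Companion.unit_map, Category.assoc,
      Companion.unit_map, F.map_comp, hidSq_comp, Category.assoc])
  naturality γ := slide_naturality _ _ _ _ _ _ _ _ _ _ _ _
    (LaxDoubleFunctor.NatTrans.sq_naturality α γ) _ _ _ _ (by simp)
    (by rw [Companion.unit_map, F.left_sq]) (by rw [Companion.unit_map, F.right_sq])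
  nat_hcomp {x y z} m n := by
    -- Compatibility of `α` with the lax comparisons lets these globular cells pass through the
    -- slide; it remains to slide an external composite, as in `slide_hcomp`.
    have h := slide_naturality_of_globular (c x) (c z) _ (by simp) (by simp) _ (by simp) (by simp)
      (F.lax m n) (G.lax m n) (LaxDoubleFunctor.NatTrans.sq_hcomp α m n) (by simp) (by simp)
      (by simp) (by simp)
    rw [h, slide_hcomp (c x) (c y) (c z) _ _ (by simp) (by simp) (by simp) (by simp)]
    simp only [Category.assoc]
  nat_hid x := by
    have h := slide_naturality_of_globular (c x) (c x) _ (by simp) (by simp) _ (by simp) (by simp)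
      (F.unit x) (G.unit x) (LaxDoubleFunctor.NatTrans.sq_hid α x) (by simp) (by simp)
      (by simp) (by simp)
    rw [h, slide_hidSq, Category.assoc]

/-- The protransformation formed by companions of the components of a natural transformation is
a companion of it. -/
def LaxOpl.companion (α : F ⟶ G)
    (c : ∀ x : D.Obj, Companion (LaxDoubleFunctor.NatTrans.app α x)) :
    Companion (X := LaxOpl D E) (x := F) (y := G) α where
  pro := OplaxProtrans.ofCompanions α c
  unit :=
    { left := 𝟙 F
      right := α
      app x := (c x).unit
      left_app x := (c x).left_unit
      right_app x := (c x).right_unit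
      internal {x y} f := (c x).unit_map (c y) (LaxDoubleFunctor.NatTrans.naturality α f)
      external {x y} m := unit_slide (c x) (c y) _ (LaxDoubleFunctor.NatTrans.left_sq α m)
        (LaxDoubleFunctor.NatTrans.right_sq α m) }
  counit :=
    { left := α
      right := 𝟙 G
      app x := (c x).counit
      left_app x := (c x).left_counit
      right_app x := (c x).right_counit
      internal {x y} f := ((c x).map_counit (c y) (LaxDoubleFunctor.NatTrans.naturality α f)).symm
      external {x y} m := slide_counit (c x) (c y) _ (LaxDoubleFunctor.NatTrans.left_sq α m)
        (LaxDoubleFunctor.NatTrans.right_sq α m) }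
  left_unit := rfl
  right_unit := rfl
  left_counit := rfl
  right_counit := rfl
  unit_counit := Modification.ext (Category.id_comp α) (Category.comp_id α)
    (by funext x; exact (c x).unit_counit)
  hsq_unit_counit := Modification.ext
    ((Category.id_comp (𝟙 F ≫ 𝟙 F)).trans (Category.id_comp (𝟙 F)))
    ((Category.id_comp (𝟙 G ≫ 𝟙 G)).trans (Category.id_comp (𝟙 G)))
    (by funext x; exact (c x).hsq_unit_counit)

end protrans

/-! ### Restriction to a class of proarrows -/

section restrictPro

variable {X : DoubleCategory.{u, v, w, t}} {K : ∀ ⦃x y : X.Obj⦄, X.Pro x y → Prop}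
  (hK : ∀ x, K (X.hid x))
  (hK' : ∀ ⦃x y z⦄ (m : X.Pro x y) (n : X.Pro y z), K m → K n → K (X.hcomp m n))

/-- A companion whose proarrow is kept is a companion in the restricted double category. -/
def Companion.restrictPro {x y : X.Obj} {f : x ⟶ y} (c : Companion f) (h : K c.pro) :
    Companion (X := X.restrictPro K hK hK') (x := x) (y := y) f where
  pro := ⟨c.pro, h⟩
  unit := c.unit
  counit := c.counit
  left_unit := c.left_unit
  right_unit := c.right_unit
  left_counit := c.left_counit
  right_counit := c.right_counit
  unit_counit := c.unit_counit
  hsq_unit_counit := c.hsq_unit_counit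

variable {Y : DoubleCategory.{u₁, v₁, w₁, t₁}}

/-- A double functor whose values on proarrows are kept factors through the restricted double
category. -/
def DoubleFunctor.restrictPro (P : DoubleFunctor Y X)
    (h : ∀ ⦃x y : Y.Obj⦄ (m : Y.Pro x y), K (P.pro m)) :
    DoubleFunctor Y (X.restrictPro K hK hK') where
  obj x := P.obj x
  map f := P.map f
  map_id := P.map_id
  map_comp := P.map_comp
  pro m := ⟨P.pro m, h m⟩
  sq α := P.sq α
  left_sq := P.left_sq
  right_sq := P.right_sq
  sq_one := P.sq_one
  sq_comp := P.sq_comp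
  lax m n := P.lax m n
  left_lax := P.left_lax
  right_lax := P.right_lax
  unit x := P.unit x
  left_unit := P.left_unit
  right_unit := P.right_unit
  lax_naturality := P.lax_naturality
  unit_naturality := P.unit_naturality
  lax_assoc := P.lax_assoc
  lax_lunit := P.lax_lunit
  lax_runit := P.lax_runit
  isIso_lax m n := by
    -- The cells are the same but invertibility refers to a different category structure, so the
    -- inverse is repackaged.
    obtain ⟨β, h₁, h₂⟩ := P.isIso_lax m n
    exact ⟨β, h₁, h₂⟩
  isIso_unit x := by
    obtain ⟨β, h₁, h₂⟩ := P.isIso_unit x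
    exact ⟨β, h₁, h₂⟩

end restrictPro

/-! ### Chosen companions and the pseudo case -/

section

variable {D : DoubleCategory.{u₁, v₁, w₁, t₁}} {E : DoubleCategory.{u₂, v₂, w₂, t₂}}
  {F G : LaxDoubleFunctor D E}

/-- A companion of a natural transformation, formed by choosing companions of its components. -/
noncomputable def HasCompanionComponents.companion {α : F ⟶ G} (h : HasCompanionComponents α) :
    Companion (X := LaxOpl D E) (x := F) (y := G) α :=
  LaxOpl.companion α fun x => (h x).some

/-- The companions witnessing the commuter condition may vary with the proarrow and need not be the
chosen ones, so independence of the choice is essential here. -/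
lemma HasCommuterComponents.isPseudo_companion {α : F ⟶ G} (h : HasCompanionComponents α)
    (h' : HasCommuterComponents α) :
    OplaxProtrans.IsPseudo (show OplaxProtrans F G from h.companion.pro) :=
  fun _ _ m => (h' m).isIso_slide _ _ (LaxDoubleFunctor.NatTrans.left_sq α m)
    (LaxDoubleFunctor.NatTrans.right_sq α m)

end

end DoubleCategory

theorem mainTheorem8 (D : DoubleCategory.{u₁, v₁, w₁, t₁}) (E : DoubleCategory.{u₂, v₂, w₂, t₂}) :
    (∃ P : DoubleCategory.DoubleFunctor (DoubleCategory.LaxComp D E).transpose.toDouble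
        (DoubleCategory.LaxOpl D E),
      P.toFunctor = DoubleCategory.LaxComp.idFunctor D E ∧
      ∀ {F G : DoubleCategory.LaxDoubleFunctor D E}
        (α : (DoubleCategory.LaxComp D E).transpose.toDouble.Pro F G),
        ∃ c : DoubleCategory.Companion (X := DoubleCategory.LaxOpl D E) (x := F) (y := G) α.1,
          HEq (P.pro α) c.pro) ∧
    (∃ P : DoubleCategory.DoubleFunctor (DoubleCategory.LaxCC D E).transpose.toDouble
        (DoubleCategory.LaxPs D E),
      P.toFunctor = DoubleCategory.LaxCC.idFunctor D E ∧
      ∀ {F G : DoubleCategory.LaxDoubleFunctor D E}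
        (α : (DoubleCategory.LaxCC D E).transpose.toDouble.Pro F G),
        ∃ c : DoubleCategory.Companion (X := DoubleCategory.LaxPs D E) (x := F) (y := G) α.1,
          HEq (P.pro α) c.pro) := by
  -- The companions that define the functor on proarrows also serve as the required witnesses, so
  -- agreement is definitional.
  refine ⟨⟨DoubleCategory.quintetFunctor (X := DoubleCategory.LaxOpl D E) _ _
      fun F G α => DoubleCategory.HasCompanionComponents.companion α.2, rfl,
      fun α => ⟨DoubleCategory.HasCompanionComponents.companion α.2, HEq.rfl⟩⟩,
    ⟨(DoubleCategory.quintetFunctor (X := DoubleCategory.LaxOpl D E) _ _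
      fun F G α => DoubleCategory.HasCompanionComponents.companion α.2.1).restrictPro _ _
        fun F G α => DoubleCategory.HasCommuterComponents.isPseudo_companion α.2.1 α.2.2, rfl,
      fun α => ⟨(DoubleCategory.HasCompanionComponents.companion α.2.1).restrictPro _ _
        (DoubleCategory.HasCommuterComponents.isPseudo_companion α.2.1 α.2.2), HEq.rfl⟩⟩⟩
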